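/- Let $K$ be a field. A \emph{bidendriform bialgebra} over $K$ is a $K$-vector space $A$ with linear maps $\prec,\succ:A\otimes A\to A$ and $\Delta_\prec,\Delta_\succ:A\to A\otimes A$ such that, writing $ab=a\prec b+a\succ b$, $\tilde\Delta=\Delta_\prec+\Delta_\succ$, $\tilde\Delta(a)=a'\otimes a''$, $\Delta_\prec(b)=b'_\prec\otimes b''_\prec$, $\Delta_\succ(b)=b'_\succ\otimes b''_\succ$, for all $a,b,c\in A$: (i) $(a\prec b)\prec c=a\prec(bc)$, $(a\succ b)\prec c=a\succ(b\prec c)$, $(ab)\succ c=a\succ(b\succ c)$; (ii) $(\Delta_\prec\otimes Id)\Delta_\prec=(Id\otimes\tilde\Delta)\Delta_\prec$, $(\Delta_\succ\otimes Id)\Delta_\prec=(Id\otimes\Delta_\prec)\Delta_\succ$, $(\tilde\Delta\otimes Id)\Delta_\succ=(Id\otimes\Delta_\succ)\Delta_\succ$; (iii) $\Delta_\succ(a\succ b)=a'b'_\succ\otimes a''\succ b''_\succ+a'\otimes a''\succ b+b'_\succ\otimes a\succ b''_\succ+ab'_\succ\otimes b''_\succ+a\otimes b$, $\Delta_\succ(a\prec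 b)=a'b'_\succ\otimes a''\prec b''_\succ+a'\otimes a''\prec b+b'_\succ\otimes a\prec b''_\succ$, $\Delta_\prec(a\succ b)=a'b'_\prec\otimes a''\succ b''_\prec+ab'_\prec\otimes b''_\prec+b'_\prec\otimes a\succ b''_\prec$, $\Delta_\prec(a\prec b)=a'b'_\prec\otimes a''\prec b''_\prec+a'b\otimes a''+b'_\prec\otimes a\prec b''_\prec+b\otimes a$. Morphisms are the linear maps compatible with the four operations. Put $\mathrm{Prim}_{tot}(A)=\ker\Delta_\prec\cap\ker\Delta_\succ$. $A$ is \emph{connected} if for every $a\in A$ there is $n\in\mathbb N$ such that $P(a)=0$ for each $P:A\to A^{\otimes(n+1)}$ which is a composition of $n$ maps of the form $Id^{\otimes i}\otimes\Delta_\prec\otimes Id^{\otimes j}$ or $Id^{\otimes i}\otimes\Delta_\succ\otimes Id^{\otimes j}$. A \emph{graded} bidendriform bialgebra is one with a decomposition $A=\bigoplus_{n\in\mathbb N}A_n$ for which the four operations are homogeneous of degree $0$. For a set $D$, let $\mathcal A^D$ be the vector space with basis the nonempty planar rooted forests decorated by $D$ (finite nonempty words in planar rooted trees with vertices decorated by $D$).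 Its operations are as follows. The product $\prec+\succ$ is concatenation of forests, and, $B_d^+(F)$ being the tree obtained by grafting the trees of the forest $F$ on a common root decorated by $d$ (so that $B_d^+(1)$ is the single vertex $d$), one has $B_d^+(F)\prec G=B_d^+(FG)$ and, for a nonempty forest $R$ and $t=B_d^+(F)$, $(tR)\prec G=t\prec(RG)+t(R\prec G)-t\prec(R\prec G)$. For a nonempty forest $F$, $\Delta_\prec(F)$ (resp. $\Delta_\succ(F)$) is the sum of the $P^c(F)\otimes R^c(F)$ over the admissible cuts $c$ of $F$, other than the empty and the total cut, which cut off (resp. do not cut off) the rightmost leaf of $F$; here $P^c(F)$ is the forest of what is cut off and $R^c(F)$ the remaining forest. Let $A$ be a bidendriform bialgebra over $K$ and $D$ a set. (1) $\mathcal A^D$ is a bidendriform bialgebra in which the single vertices $d\in D$ are totally primitive. For every family $(p_d)_{d\in D}$ of elements of $\mathrm{Prim}_{tot}(A)$ there is a unique morphism of bidendriform bialgebras $\Psi:\mathcal A^D\to A$ sending the single vertex $d$ to $p_d$ for all $d\in D$. Moreover: if the $p_d$ are linearly independent, $\Psi$ is injective; if $A$ is connected and the $p_d$ span $\mathrm{Prim}_{tot}(A)$,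 $\Psi$ is surjective; if $A$ is connected and $(p_d)$ is a basis of $\mathrm{Prim}_{tot}(A)$, $\Psi$ is an isomorphism of bidendriform bialgebras. (2) Suppose that $A=\bigoplus_{n\in\mathbb N} A_n$ is graded and connected, that $(p_d)_{d\in D}$ is a basis of $\mathrm{Prim}_{tot}(A)$ and that $p_d\in A_{|d|}$ with $|d|\in\mathbb N$ for all $d$. Give a forest the degree $\sum_s|\text{decoration of }s|$, the sum being over its vertices $s$. Then $\mathcal A^D$ is a graded bidendriform bialgebra and the morphism $\Psi$ of (1) is an isomorphism of graded bidendriform bialgebras. (3) If $A$ is connected, then there is a basis $B$ of $\mathrm{Prim}_{tot}(A)$ and an isomorphism of bidendriform bialgebras $\mathcal A^B\to A$ sending the single vertex $b$ to $b$ for all $b\in B$. If moreover $A$ is graded, then there are such a basis $B$ consisting of homogeneous elements and, for the grading of $\mathcal A^B$ given by the degrees of the elements of $B$ as in (2), an isomorphism of graded bidendriform bialgebras $\mathcal A^B\to A$ sending the single vertex $b$ to $b$ for all $b\in B$. -/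

import Mathlib

open scoped TensorProduct

/-! ## Bidendriform bialgebras -/

/-- The four structure maps `≺, ≻ : A ⊗ A → A` (given as bilinear maps) and
`Δ_≺, Δ_≻ : A → A ⊗ A` on a vector space `A`; the axioms are in
`BidendriformData.IsBialgebra`. -/
structure BidendriformData (K A : Type*) [Field K] [AddCommGroup A] [Module K A] where
  /-- the left product `a ≺ b` -/
  prec : A →ₗ[K] A →ₗ[K] A
  /-- the right product `a ≻ b` -/
  succ : A →ₗ[K] A →ₗ[K] A
  /-- the left coproduct -/
  coprec : A →ₗ[K] A ⊗[K] A
  /-- the right coproduct -/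
  cosucc : A →ₗ[K] A ⊗[K] A

namespace BidendriformData

section Axioms

variable {K A : Type*} [Field K] [AddCommGroup A] [Module K A]

/-- The product `a b = a ≺ b + a ≻ b`. -/
def mul (S : BidendriformData K A) : A →ₗ[K] A →ₗ[K] A := S.prec + S.succ

/-- The (non counitary) coproduct `Δ_≺ + Δ_≻`, written `a ↦ a' ⊗ a''`. -/
noncomputable def comul (S : BidendriformData K A) : A →ₗ[K] A ⊗[K] A := S.coprec + S.cosucc

/-- The axioms of a dendriform algebra. -/
structure IsDendriformAlgebra (S : BidendriformData K A) : Prop where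
  prec_prec : ∀ a b c : A,
    S.prec (S.prec a b) c = S.prec a (S.prec b c + S.succ b c)
  succ_prec : ∀ a b c : A,
    S.prec (S.succ a b) c = S.succ a (S.prec b c)
  succ_succ : ∀ a b c : A,
    S.succ (S.prec a b + S.succ a b) c = S.succ a (S.succ b c)

/-- The axioms of a dendriform coalgebra
(`f.rTensor A = f ⊗ Id` and `f.lTensor A = Id ⊗ f`). -/
structure IsDendriformCoalgebra (S : BidendriformData K A) : Prop where
  coprec_coprec : ∀ a : A,
    TensorProduct.assoc K A A A (S.coprec.rTensor A (S.coprec a)) =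
      S.coprec.lTensor A (S.coprec a) + S.cosucc.lTensor A (S.coprec a)
  cosucc_coprec : ∀ a : A,
    TensorProduct.assoc K A A A (S.cosucc.rTensor A (S.coprec a)) =
      S.coprec.lTensor A (S.cosucc a)
  cosucc_cosucc : ∀ a : A,
    TensorProduct.assoc K A A A
        (S.coprec.rTensor A (S.cosucc a) + S.cosucc.rTensor A (S.cosucc a)) =
      S.cosucc.lTensor A (S.cosucc a)

/-- The axioms of a bidendriform bialgebra. In Sweedler-type notation, where `a' ⊗ a''` is
`Δ_≺ a + Δ_≻ a`, `b'_≺ ⊗ b''_≺ = Δ_≺ b` and `b'_≻ ⊗ b''_≻ = Δ_≻ b`, the compatibilities are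
* `Δ_≻ (a ≻ b) = a' b'_≻ ⊗ a'' ≻ b''_≻ + a' ⊗ a'' ≻ b + b'_≻ ⊗ a ≻ b''_≻ + a b'_≻ ⊗ b''_≻ + a ⊗ b`,
* `Δ_≻ (a ≺ b) = a' b'_≻ ⊗ a'' ≺ b''_≻ + a' ⊗ a'' ≺ b + b'_≻ ⊗ a ≺ b''_≻`,
* `Δ_≺ (a ≻ b) = a' b'_≺ ⊗ a'' ≻ b''_≺ + a b'_≺ ⊗ b''_≺ + b'_≺ ⊗ a ≻ b''_≺`,
* `Δ_≺ (a ≺ b) = a' b'_≺ ⊗ a'' ≺ b''_≺ + a' b ⊗ a'' + b'_≺ ⊗ a ≺ b''_≺ + b ⊗ a`. -/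
structure IsBialgebra (S : BidendriformData K A) : Prop where
  algebra : S.IsDendriformAlgebra
  coalgebra : S.IsDendriformCoalgebra
  cosucc_succ : ∀ a b : A,
    S.cosucc (S.succ a b) =
      TensorProduct.map₂ S.mul S.succ (S.comul a) (S.cosucc b)
        + (S.succ.flip b).lTensor A (S.comul a)
        + (S.succ a).lTensor A (S.cosucc b)
        + (S.mul a).rTensor A (S.cosucc b)
        + a ⊗ₜ[K] b
  cosucc_prec : ∀ a b : A,
    S.cosucc (S.prec a b) =
      TensorProduct.map₂ S.mul S.prec (S.comul a) (S.cosucc b)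
        + (S.prec.flip b).lTensor A (S.comul a)
        + (S.prec a).lTensor A (S.cosucc b)
  coprec_succ : ∀ a b : A,
    S.coprec (S.succ a b) =
      TensorProduct.map₂ S.mul S.succ (S.comul a) (S.coprec b)
        + (S.mul a).rTensor A (S.coprec b)
        + (S.succ a).lTensor A (S.coprec b)
  coprec_prec : ∀ a b : A,
    S.coprec (S.prec a b) =
      TensorProduct.map₂ S.mul S.prec (S.comul a) (S.coprec b)
        + (S.mul.flip b).rTensor A (S.comul a)
        + (S.prec a).lTensor A (S.coprec b)
        + b ⊗ₜ[K] a

/-- The space of totally primitive elements, `Ker Δ_≺ ∩ Ker Δ_≻`. -/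
noncomputable def primTot (S : BidendriformData K A) : Submodule K A :=
  LinearMap.ker S.coprec ⊓ LinearMap.ker S.cosucc

end Axioms

section Connected

variable {K : Type*} {C : Type*} [Field K] [AddCommGroup C] [Module K C]

/-- `tensorPow K C n` is the tensor power `C^{⊗ (n+1)} = C ⊗ (C ⊗ (⋯ ⊗ C))`. -/
noncomputable def tensorPow (K C : Type*) [Field K] [AddCommGroup C] [Module K C] :
    ℕ → ModuleCat K
  | 0 => ModuleCat.of K C
  | n + 1 => ModuleCat.of K (C ⊗[K] tensorPow K C n)

/-- `applyAt δ n i : C^{⊗ (n+1)} → C^{⊗ (n+2)}` applies `δ : C → C ⊗ C` to the tensor factor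
number `i`, that is, it is `Id^{⊗ i} ⊗ δ ⊗ Id^{⊗ (n-i)}` (factors numbered from `0`). -/
noncomputable def applyAt (δ : C →ₗ[K] C ⊗[K] C) :
    (n : ℕ) → Fin (n + 1) → (tensorPow K C n →ₗ[K] tensorPow K C (n + 1))
  | 0, _ => δ
  | n + 1, i => Fin.cases
      ((TensorProduct.assoc K C C (tensorPow K C n)).toLinearMap ∘ₗ
        δ.rTensor (tensorPow K C n))
      (fun j => (applyAt δ n j).lTensor C) i

/-- `S.IsIteratedCoproduct n P` says that `P : C → C^{⊗ (n+1)}` is a composition of `n` maps of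
the form `Id ⊗ ⋯ ⊗ Δ_≺ ⊗ ⋯ ⊗ Id` or `Id ⊗ ⋯ ⊗ Δ_≻ ⊗ ⋯ ⊗ Id`. -/
inductive IsIteratedCoproduct (S : BidendriformData K C) :
    (n : ℕ) → (C →ₗ[K] tensorPow K C n) → Prop
  | id : IsIteratedCoproduct S 0 (LinearMap.id : C →ₗ[K] C)
  | coprec (n : ℕ) (P : C →ₗ[K] tensorPow K C n) (i : Fin (n + 1)) :
      IsIteratedCoproduct S n P → IsIteratedCoproduct S (n + 1) (applyAt S.coprec n i ∘ₗ P)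
  | cosucc (n : ℕ) (P : C →ₗ[K] tensorPow K C n) (i : Fin (n + 1)) :
      IsIteratedCoproduct S n P → IsIteratedCoproduct S (n + 1) (applyAt S.cosucc n i ∘ₗ P)

/-- Connectedness of the dendriform coalgebra `(C, Δ_≺, Δ_≻)`: every element is killed by all
iterated coproducts of some order. -/
def IsConnected (S : BidendriformData K C) : Prop :=
  ∀ a : C, ∃ n : ℕ, ∀ P : C →ₗ[K] tensorPow K C n, S.IsIteratedCoproduct n P → P a = 0

end Connected

section Morphisms

variable {K A B : Type*} [Field K] [AddCommGroup A] [Module K A] [AddCommGroup B] [Module K B]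

/-- Morphisms of bidendriform bialgebras: linear maps compatible with `≺, ≻, Δ_≺, Δ_≻`. -/
structure IsHom (S : BidendriformData K A) (T : BidendriformData K B) (Ψ : A →ₗ[K] B) :
    Prop where
  map_prec : ∀ a b : A, Ψ (S.prec a b) = T.prec (Ψ a) (Ψ b)
  map_succ : ∀ a b : A, Ψ (S.succ a b) = T.succ (Ψ a) (Ψ b)
  map_coprec : ∀ a : A, T.coprec (Ψ a) = TensorProduct.map Ψ Ψ (S.coprec a)
  map_cosucc : ∀ a : A, T.cosucc (Ψ a) = TensorProduct.map Ψ Ψ (S.cosucc a)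

/-- Isomorphisms of bidendriform bialgebras: morphisms with a two-sided inverse morphism. -/
def IsIso (S : BidendriformData K A) (T : BidendriformData K B) (Ψ : A →ₗ[K] B) : Prop :=
  S.IsHom T Ψ ∧ ∃ Θ : B →ₗ[K] A, T.IsHom S Θ ∧ Θ ∘ₗ Ψ = LinearMap.id ∧ Ψ ∘ₗ Θ = LinearMap.id

/-- `A = ⨁ 𝒜 n` is an `ℕ`-grading for which `≺, ≻, Δ_≺, Δ_≻` are homogeneous of degree `0`. -/
structure IsGrading (S : BidendriformData K A) (𝒜 : ℕ → Submodule K A) : Prop where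
  isInternal : DirectSum.IsInternal 𝒜
  prec_mem : ∀ i j : ℕ, ∀ a ∈ 𝒜 i, ∀ b ∈ 𝒜 j, S.prec a b ∈ 𝒜 (i + j)
  succ_mem : ∀ i j : ℕ, ∀ a ∈ 𝒜 i, ∀ b ∈ 𝒜 j, S.succ a b ∈ 𝒜 (i + j)
  coprec_mem : ∀ n : ℕ, ∀ a ∈ 𝒜 n, S.coprec a ∈
    ⨆ ij ∈ Finset.HasAntidiagonal.antidiagonal n,
      LinearMap.range (TensorProduct.mapIncl (𝒜 ij.1) (𝒜 ij.2))
  cosucc_mem : ∀ n : ℕ, ∀ a ∈ 𝒜 n, S.cosucc a ∈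
    ⨆ ij ∈ Finset.HasAntidiagonal.antidiagonal n,
      LinearMap.range (TensorProduct.mapIncl (𝒜 ij.1) (𝒜 ij.2))

/-- Isomorphisms of graded bidendriform bialgebras: isomorphisms which, together with their
inverses, preserve the degree. -/
def IsGradedIso (S : BidendriformData K A) (𝒜 : ℕ → Submodule K A)
    (T : BidendriformData K B) (ℬ : ℕ → Submodule K B) (Ψ : A →ₗ[K] B) : Prop :=
  S.IsIso T Ψ ∧ ∀ n : ℕ, (𝒜 n).map Ψ = ℬ n

end Morphisms

end BidendriformData

/-! ## Planar decorated rooted forests -/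

/-- Planar rooted forests decorated by `D`, i.e. finite words `t₁ … tₙ` in planar rooted trees
decorated by `D`. A forest is either empty, or it is given by its first tree and the forest `rest`
formed by the remaining trees; the first tree is given by the decoration `d` of its root and the
forest `children` of the subtrees grafted on this root, from left to right. -/
inductive PlanarForest (D : Type*) where
  | nil : PlanarForest D
  | cons (d : D) (children rest : PlanarForest D) : PlanarForest D

namespace PlanarForest

section Forests

variable {D : Type*}

/-- The product `F G` of two forests: concatenation. -/
def append : PlanarForest D → PlanarForest D → PlanarForest D
  | nil, G => G
  | cons d C R, G => cons d C (append R G)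

/-- The tree `B_d^+(F)` obtained by grafting the trees of `F` on a common root decorated by `d`. -/
def graft (d : D) (F : PlanarForest D) : PlanarForest D := cons d F nil

/-- The sum of the degrees of the decorations of all vertices. -/
def degree (deg : D → ℕ) : PlanarForest D → ℕ
  | nil => 0
  | cons d C R => deg d + degree deg C + degree deg R

/-- The data recorded about an admissible cut `c` of a forest `F`: the pruned part `P^c(F)`, the
trunk `R^c(F)` which contains the roots that are kept, and whether the rightmost leaf of `F` (the
leaf reached from the root of the last tree of `F` by always going to the last child) is cut off,
i.e. belongs to `P^c(F)`. -/
structure Cut (D : Type*) where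
  /-- the pruned part `P^c(F)` -/
  pruned : PlanarForest D
  /-- the trunk `R^c(F)` -/
  trunk : PlanarForest D
  /-- does `c` cut off the rightmost leaf of `F`? -/
  cutsLastLeaf : Bool

/-- The list of all admissible cuts of a forest, including the empty and the total cut.
An admissible cut of `t₁ … tₙ` consists of cuts of the `tᵢ`; a cut of a tree `B_d^+(C)` is either
total, or keeps the root and is given by an admissible cut of `C` (cutting an edge which starts at
the root means cutting totally the corresponding tree of `C`). -/
def cuts : PlanarForest D → List (Cut D)
  | nil => [⟨nil, nil, false⟩]
  | cons d C R =>
    ((cuts R).map fun c =>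
      { pruned := cons d C c.pruned
        trunk := c.trunk
        cutsLastLeaf := match R with
          | nil => true
          | cons _ _ _ => c.cutsLastLeaf }) ++
    ((cuts C).flatMap fun b => (cuts R).map fun c =>
      { pruned := append b.pruned c.pruned
        trunk := cons d b.trunk c.trunk
        cutsLastLeaf := match R with
          | nil => b.cutsLastLeaf
          | cons _ _ _ => c.cutsLastLeaf })

end Forests

end PlanarForest

/-! ## The bidendriform bialgebra of planar decorated forests -/

/-- The vector space `𝒜^D` with basis the nonempty planar forests decorated by `D`: the
augmentation ideal of the Hopf algebra of planar decorated rooted trees. -/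
def ForestSpace (K D : Type*) [Field K] : Type _ :=
  {F : PlanarForest D // F ≠ PlanarForest.nil} →₀ K

namespace ForestSpace

section Structure

noncomputable instance instAddCommGroup (K D : Type*) [Field K] :
    AddCommGroup (ForestSpace K D) :=
  inferInstanceAs (AddCommGroup ({F : PlanarForest D // F ≠ PlanarForest.nil} →₀ K))

noncomputable instance instModule (K D : Type*) [Field K] : Module K (ForestSpace K D) :=
  inferInstanceAs (Module K ({F : PlanarForest D // F ≠ PlanarForest.nil} →₀ K))

/-- The basis of nonempty forests. -/
noncomputable def forestBasis (K D : Type*) [Field K] :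
    Module.Basis {F : PlanarForest D // F ≠ PlanarForest.nil} K (ForestSpace K D) :=
  Module.Basis.ofRepr
    (LinearEquiv.refl K ({F : PlanarForest D // F ≠ PlanarForest.nil} →₀ K))

variable (K : Type*) {D : Type*} [Field K]

/-- The basis element attached to a nonempty forest; the empty forest is sent to `0`. -/
noncomputable def ofForest : PlanarForest D → ForestSpace K D
  | PlanarForest.nil => 0
  | PlanarForest.cons d C R =>
    forestBasis K D ⟨PlanarForest.cons d C R, by intro h; cases h⟩

/-- The single vertex decorated by `d`. -/
noncomputable def vertex (d : D) : ForestSpace K D :=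
  ofForest K (PlanarForest.graft d PlanarForest.nil)

/-- The linear extension of a map from forests to a vector space. -/
noncomputable def extend {M : Type*} [AddCommGroup M] [Module K M] (f : PlanarForest D → M) :
    ForestSpace K D →ₗ[K] M :=
  (forestBasis K D).constr K fun F => f F.1

/-- The bilinear extension of a map from pairs of forests to a vector space. -/
noncomputable def extend₂ {M : Type*} [AddCommGroup M] [Module K M]
    (f : PlanarForest D → PlanarForest D → M) :
    ForestSpace K D →ₗ[K] ForestSpace K D →ₗ[K] M :=
  extend K fun F => extend K fun G => f F G

/-- The left product `F ≺ G` of two nonempty forests (with the convention `1 ≺ G = 0`).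
On a first factor with a single tree it is `B_d^+(C) ≺ G = B_d^+(C G)`; in particular
`d ≺ G = B_d^+(G)`. For `t = B_d^+(C)` one has `(t R) ≺ G = (t ≺ R + t ≻ R) ≺ G
= t ≺ (R G) + t ≻ (R ≺ G) = B_d^+(C R G) + t (R ≺ G) - B_d^+(C (R ≺ G))`. -/
noncomputable def precForest : PlanarForest D → PlanarForest D → ForestSpace K D
  | PlanarForest.nil, _ => 0
  | PlanarForest.cons d C R, G =>
    ofForest K (PlanarForest.graft d (C.append (R.append G)))
      + extend K (fun F => ofForest K ((PlanarForest.graft d C).append F)) (precForest R G)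
      - extend K (fun F => ofForest K (PlanarForest.graft d (C.append F))) (precForest R G)

/-- For a Boolean `b`, the sum of `P^c(F) ⊗ R^c(F)` over the admissible cuts `c` of `F` other than
the empty and the total cut (their terms vanish since `ofForest` kills the empty forest) which cut
off the rightmost leaf of `F` (if `b = true`), resp. do not cut it off (if `b = false`). -/
noncomputable def cutSum (b : Bool) (F : PlanarForest D) : ForestSpace K D ⊗[K] ForestSpace K D :=
  ((F.cuts.filter fun c => c.cutsLastLeaf == b).map fun c =>
    ofForest K c.pruned ⊗ₜ[K] ofForest K c.trunk).sum

/-- The structure maps of `𝒜^D`. The right product is determined by the requirement that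
`≺ + ≻` is concatenation. The left coproduct `Δ_≺(F)` is the sum of `P^c(F) ⊗ R^c(F)` over the
nonempty nontotal admissible cuts `c` which cut off the rightmost leaf of `F`, that is, which cut
an edge on the path from the root of the last tree of `F` to its rightmost leaf or cut totally
this last tree; `Δ_≻(F)` is the sum over the other nonempty nontotal admissible cuts. -/
noncomputable def data (K D : Type*) [Field K] : BidendriformData K (ForestSpace K D) where
  prec := extend₂ K (precForest K)
  succ := extend₂ K fun F G => ofForest K (F.append G) - precForest K F G
  coprec := extend K (cutSum K true)
  cosucc := extend K (cutSum K false)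

/-- The grading of `𝒜^D` induced by a grading `deg` of `D`: the homogeneous part of degree `n` is
spanned by the nonempty forests of degree `n`. -/
noncomputable def grading (deg : D → ℕ) (n : ℕ) : Submodule K (ForestSpace K D) :=
  Submodule.span K
    {x | ∃ F : PlanarForest D, F ≠ PlanarForest.nil ∧ F.degree deg = n ∧ ofForest K F = x}

end Structure

end ForestSpace

/-!
The operations on forests are handled through sums over all admissible cuts, the empty and the
total one included: `sumCuts F f` is the sum of `f P^c(F) R^c(F)`, and `sumCutsOf b F f` keeps the
cuts which do (`b = true`) or do not (`b = false`) cut off the rightmost leaf. A cut of `F G` is a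
pair of cuts (`sumCuts_append`, `sumCutsOf_append`), from which the coassociativity relations
follow by induction on the forest. The same induction shows that the cuts of `F ≺ G` are obtained by
concatenating what is cut off from `F` and `G` and taking the left product of what remains
(`sumCutsOf_precForest`). Separating the terms in which one of the four parts is empty turns this
single formula into the compatibilities between products and coproducts (`isBialgebra`).

For the universal property, `B_d^+(C) = d ≺ C` and multiplicativity force the images of the forests
(`evalForest`); the resulting map respects the products, and it respects the coproducts because it
does so on the vertices, which generate `𝒜^D`.

The structure theorem rests on two operators, defined by recursion on the coproducts of a
bidendriform bialgebra in which these are locally nilpotent: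
`E a = a - a''_≺ · E a'_≺` is a projection onto `Ker Δ_≺`, and `F a = a - a'_≻ ≻ F a''_≻` is a
projection onto `Ker Δ_≻` which preserves `Ker Δ_≺` (`leftProj`, `rightProj`). Hence `F ∘ E` takes
its values in `Prim_tot`.
* In a connected `A` it follows that a subspace which is stable under the operations and contains
  `Prim_tot(A)` contains every `a` whose coproducts it contains, hence is everything
  (`IsBialgebra.eq_top_of_primTot_le`). This gives surjectivity.
* As `E` kills the products `a u` with `u ∈ Ker Δ_≺`, and `F` kills the products `a ≻ v` with
  `v ∈ Ker Δ_≻`, and as `𝒜^D` is spanned by such elements and by the vertices, the totally primitive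
  elements of `𝒜^D` are the linear combinations of vertices (`primTot_eq_span`). An element with
  the fewest vertices in the kernel of a morphism is totally primitive, which gives injectivity.

In the graded case the coproducts are homogeneous, so that `Prim_tot(A)` is spanned by homogeneous
elements (`IsGrading.span_homogeneous_primTot`) and a basis may be extracted from them.
-/

namespace PlanarForest

/-! ### Concatenation of forests -/

section Append

variable {D : Type*}

@[simp] lemma nil_append (F : PlanarForest D) : append nil F = F := rfl

@[simp] lemma cons_append (d : D) (C R F : PlanarForest D) :
    append (cons d C R) F = cons d C (append R F) := rfl

@[simp] lemma append_nil (F : PlanarForest D) : append F nil = F := by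
  induction F with
  | nil => rfl
  | cons d C R _ ih => simp [ih]

@[simp] lemma append_assoc (F G H : PlanarForest D) :
    append (append F G) H = append F (append G H) := by
  induction F with
  | nil => rfl
  | cons d C R _ ih => simp [ih]

@[simp] lemma cons_ne_nil (d : D) (C R : PlanarForest D) : cons d C R ≠ nil := by
  intro h; cases h

lemma append_ne_nil_right (F : PlanarForest D) {G : PlanarForest D} (hG : G ≠ nil) :
    append F G ≠ nil := by
  cases F with
  | nil => exact hG
  | cons d C R => simp

lemma degree_append (deg : D → ℕ) (F G : PlanarForest D) :
    (append F G).degree deg = F.degree deg + G.degree deg := by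
  induction F with
  | nil => simp [degree]
  | cons d C R _ ih => simp only [cons_append, degree, ih]; ring

/-- The number of vertices of a forest. -/
def size (F : PlanarForest D) : ℕ := F.degree fun _ => 1

lemma size_pos {F : PlanarForest D} (hF : F ≠ nil) : 0 < F.size := by
  cases F with
  | nil => exact absurd rfl hF
  | cons d C R => simp only [size, degree]; omega

end Append

/-! ### Sums over admissible cuts -/

section Sums

variable {D V W : Type*} [AddCommGroup V] [AddCommGroup W]

/-- The sum of `f P^c(F) R^c(F)` over all admissible cuts `c` of `F`, the empty and the total cut
included. -/
def sumCuts (F : PlanarForest D) (f : PlanarForest D → PlanarForest D → V) : V :=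
  (F.cuts.map fun c => f c.pruned c.trunk).sum

/-- The sum of `f P^c(F) R^c(F)` over the admissible cuts `c` of `F` which cut off the rightmost
leaf (`b = true`), resp. do not cut it off (`b = false`). The empty and the total cut are included;
the only cut of the empty forest counts for `b = false`. -/
def sumCutsOf (b : Bool) (F : PlanarForest D) (f : PlanarForest D → PlanarForest D → V) : V :=
  (F.cuts.map fun c => if c.cutsLastLeaf = b then f c.pruned c.trunk else 0).sum

lemma sum_map_cuts_cons (d : D) (C R : PlanarForest D) (g : Cut D → V) :
    ((cons d C R).cuts.map g).sum =
      (R.cuts.map fun c => g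
        { pruned := cons d C c.pruned
          trunk := c.trunk
          cutsLastLeaf := match R with
            | nil => true
            | cons _ _ _ => c.cutsLastLeaf }).sum +
      (C.cuts.map fun b => (R.cuts.map fun c => g
        { pruned := append b.pruned c.pruned
          trunk := cons d b.trunk c.trunk
          cutsLastLeaf := match R with
            | nil => b.cutsLastLeaf
            | cons _ _ _ => c.cutsLastLeaf }).sum).sum := by
  rw [cuts]
  simp only [List.map_append, List.sum_append, List.map_map, List.map_flatMap]
  congr 1
  rw [List.flatMap, List.sum_flatten, List.map_map]
  rfl

@[simp] lemma sumCuts_nil (f : PlanarForest D → PlanarForest D → V) :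
    sumCuts nil f = f nil nil := by simp [sumCuts, cuts]

@[simp] lemma sumCutsOf_true_nil (f : PlanarForest D → PlanarForest D → V) :
    sumCutsOf true nil f = 0 := by simp [sumCutsOf, cuts]

@[simp] lemma sumCutsOf_false_nil (f : PlanarForest D → PlanarForest D → V) :
    sumCutsOf false nil f = f nil nil := by simp [sumCutsOf, cuts]

lemma sumCuts_cons (d : D) (C R : PlanarForest D) (f : PlanarForest D → PlanarForest D → V) :
    sumCuts (cons d C R) f = sumCuts R (fun p t => f (cons d C p) t) +
      sumCuts C fun e s => sumCuts R fun p t => f (append e p) (cons d s t) := by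
  simp only [sumCuts, sum_map_cuts_cons]

lemma sumCutsOf_cons (b : Bool) (d : D) (C : PlanarForest D) {R : PlanarForest D} (hR : R ≠ nil)
    (f : PlanarForest D → PlanarForest D → V) :
    sumCutsOf b (cons d C R) f = sumCutsOf b R (fun p t => f (cons d C p) t) +
      sumCuts C fun e s => sumCutsOf b R fun p t => f (append e p) (cons d s t) := by
  cases R with
  | nil => exact absurd rfl hR
  | cons d' C' R' => simp only [sumCuts, sumCutsOf, sum_map_cuts_cons d C]

/-- The cuts of a tree `B_d^+(C)` are the total cut, which cuts off the rightmost leaf, and the cuts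
of `C`. If `C` is empty, its only cut counts for `b = false`, as it leaves the leaf `d`. -/
lemma sumCutsOf_true_graft (d : D) (C : PlanarForest D)
    (f : PlanarForest D → PlanarForest D → V) :
    sumCutsOf true (cons d C nil) f =
      f (cons d C nil) nil + sumCutsOf true C fun p t => f p (cons d t nil) := by
  simp only [sumCutsOf, sum_map_cuts_cons d C]
  simp [cuts]

lemma sumCutsOf_false_graft (d : D) (C : PlanarForest D)
    (f : PlanarForest D → PlanarForest D → V) :
    sumCutsOf false (cons d C nil) f = sumCutsOf false C fun p t => f p (cons d t nil) := by
  simp only [sumCutsOf, sum_map_cuts_cons d C]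
  simp [cuts]

lemma sumCuts_add (F : PlanarForest D) (f g : PlanarForest D → PlanarForest D → V) :
    (sumCuts F fun p t => f p t + g p t) = sumCuts F f + sumCuts F g := by
  simp [sumCuts, List.sum_map_add]

lemma sumCutsOf_add (b : Bool) (F : PlanarForest D) (f g : PlanarForest D → PlanarForest D → V) :
    (sumCutsOf b F fun p t => f p t + g p t) = sumCutsOf b F f + sumCutsOf b F g := by
  simp only [sumCutsOf, ← List.sum_map_add]
  congr 2; funext c; split <;> simp

lemma map_sumCuts {M : Type*} [FunLike M V W] [AddMonoidHomClass M V W] (φ : M)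
    (F : PlanarForest D) (f : PlanarForest D → PlanarForest D → V) :
    φ (sumCuts F f) = sumCuts F fun p t => φ (f p t) := by
  simp [sumCuts, map_list_sum, Function.comp_def]

lemma map_sumCutsOf {M : Type*} [FunLike M V W] [AddMonoidHomClass M V W] (φ : M) (b : Bool)
    (F : PlanarForest D) (f : PlanarForest D → PlanarForest D → V) :
    φ (sumCutsOf b F f) = sumCutsOf b F fun p t => φ (f p t) := by
  simp only [sumCutsOf, map_list_sum, List.map_map, Function.comp_def, apply_ite φ, map_zero]

lemma sumCutsOf_true_add_false (F : PlanarForest D) (f : PlanarForest D → PlanarForest D → V) :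
    sumCutsOf true F f + sumCutsOf false F f = sumCuts F f := by
  simp only [sumCuts, sumCutsOf, ← List.sum_map_add]
  congr 2; funext c; cases c.cutsLastLeaf <;> simp

lemma sumCuts_congr {F : PlanarForest D} {f g : PlanarForest D → PlanarForest D → V}
    (h : ∀ c ∈ F.cuts, f c.pruned c.trunk = g c.pruned c.trunk) : sumCuts F f = sumCuts F g := by
  simp only [sumCuts]
  rw [List.map_congr_left h]

lemma sumCutsOf_congr {b : Bool} {F : PlanarForest D} {f g : PlanarForest D → PlanarForest D → V}
    (h : ∀ c ∈ F.cuts, c.cutsLastLeaf = b → f c.pruned c.trunk = g c.pruned c.trunk) :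
    sumCutsOf b F f = sumCutsOf b F g := by
  simp only [sumCutsOf]
  refine congrArg _ (List.map_congr_left fun c hc => ?_)
  split
  · exact h c hc ‹_›
  · rfl

lemma sumCuts_swap (C : PlanarForest D) (b : Bool) (R : PlanarForest D)
    (f : PlanarForest D → PlanarForest D → PlanarForest D → PlanarForest D → V) :
    (sumCuts C fun e s => sumCutsOf b R fun p t => f e s p t) =
      sumCutsOf b R fun p t => sumCuts C fun e s => f e s p t := by
  unfold sumCuts
  induction C.cuts with
  | nil => simp [sumCutsOf]
  | cons c l ih => simp only [List.map_cons, List.sum_cons, ih, sumCutsOf_add]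

lemma sumCuts_comm (C R : PlanarForest D)
    (f : PlanarForest D → PlanarForest D → PlanarForest D → PlanarForest D → V) :
    (sumCuts C fun e s => sumCuts R fun p t => f e s p t) =
      sumCuts R fun p t => sumCuts C fun e s => f e s p t := by
  simp only [← sumCutsOf_true_add_false R, sumCuts_add, sumCuts_swap]

/-- A cut of `F G` consists of a cut of `F` and a cut of `G`. -/
lemma sumCuts_append (F G : PlanarForest D) (f : PlanarForest D → PlanarForest D → V) :
    sumCuts (append F G) f =
      sumCuts F fun p t => sumCuts G fun q s => f (append p q) (append t s) := by
  induction F generalizing f with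
  | nil => simp
  | cons d C R _ ih => simp only [cons_append, sumCuts_cons, ih, append_assoc]

/-- The rightmost leaf of `F G` is the one of `G` if `G` is not empty. -/
lemma sumCutsOf_append (b : Bool) (F : PlanarForest D) {G : PlanarForest D} (hG : G ≠ nil)
    (f : PlanarForest D → PlanarForest D → V) :
    sumCutsOf b (append F G) f =
      sumCuts F fun p t => sumCutsOf b G fun q s => f (append p q) (append t s) := by
  induction F generalizing f with
  | nil => simp
  | cons d C R _ ih =>
    simp only [cons_append, sumCuts_cons, sumCutsOf_cons b d C (append_ne_nil_right R hG), ih,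
      append_assoc]

end Sums

/-! ### The parts of a cut -/

section Cuts

variable {D : Type*}

lemma degree_of_mem_cuts (deg : D → ℕ) {F : PlanarForest D} {c : Cut D} (hc : c ∈ F.cuts) :
    c.pruned.degree deg + c.trunk.degree deg = F.degree deg := by
  induction F generalizing c with
  | nil => simp [cuts] at hc; subst hc; simp [degree]
  | cons d C R ihC ihR =>
    simp only [cuts, List.mem_append, List.mem_map, List.mem_flatMap] at hc
    rcases hc with ⟨r, hr, rfl⟩ | ⟨e, he, r, hr, rfl⟩
    · have := ihR hr
      simp only [degree]; omega
    · have h1 := ihR hr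
      have h2 := ihC he
      simp only [degree, degree_append]; omega

/-- A cut which cuts off the rightmost leaf is not the empty one. -/
lemma pruned_ne_nil_of_cutsLastLeaf {F : PlanarForest D} {c : Cut D} (hc : c ∈ F.cuts)
    (h : c.cutsLastLeaf = true) : c.pruned ≠ nil := by
  induction F generalizing c with
  | nil => simp [cuts] at hc; subst hc; simp at h
  | cons d C R ihC ihR =>
    simp only [cuts, List.mem_append, List.mem_map, List.mem_flatMap] at hc
    rcases hc with ⟨r, hr, rfl⟩ | ⟨e, he, r, hr, rfl⟩
    · simp
    · cases R with
      | nil =>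
        simp [cuts] at hr
        subst hr
        simpa using ihC he h
      | cons d' C' R' => exact append_ne_nil_right _ (ihR hr (show r.cutsLastLeaf = true from h))

/-- A cut which does not cut off the rightmost leaf is not the total one. -/
lemma trunk_ne_nil_of_not_cutsLastLeaf {F : PlanarForest D} (hF : F ≠ nil) {c : Cut D}
    (hc : c ∈ F.cuts) (h : c.cutsLastLeaf = false) : c.trunk ≠ nil := by
  induction F generalizing c with
  | nil => exact absurd rfl hF
  | cons d C R ihC ihR =>
    simp only [cuts, List.mem_append, List.mem_map, List.mem_flatMap] at hc
    rcases hc with ⟨r, hr, rfl⟩ | ⟨e, he, r, hr, rfl⟩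
    · cases R with
      | nil => simp at h
      | cons d' C' R' =>
        exact (ihR (by simp) hr (show r.cutsLastLeaf = false from h) : r.trunk ≠ nil)
    · simp

end Cuts

/-! ### Counital terms -/

section Epsilon

variable {D V : Type*} [AddCommGroup V]

/-- Multiplication of `v` by the counit of `F`: it is `v` if `F` is empty, and `0` otherwise. -/
def epsilon (F : PlanarForest D) (v : V) : V :=
  match F with
  | nil => v
  | cons _ _ _ => 0

@[simp] lemma epsilon_nil (v : V) : epsilon (nil : PlanarForest D) v = v := rfl

@[simp] lemma epsilon_cons (d : D) (C R : PlanarForest D) (v : V) :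
    epsilon (cons d C R) v = 0 := rfl

lemma epsilon_of_ne_nil {F : PlanarForest D} (hF : F ≠ nil) (v : V) : epsilon F v = 0 := by
  cases F with
  | nil => exact absurd rfl hF
  | cons d C R => rfl

@[simp] lemma epsilon_append (F G : PlanarForest D) (v : V) :
    epsilon (append F G) v = epsilon F (epsilon G v) := by
  cases F <;> simp

@[simp] lemma epsilon_zero (F : PlanarForest D) : epsilon F (0 : V) = 0 := by
  cases F <;> simp

@[simp] lemma sumCuts_zero (F : PlanarForest D) : (sumCuts F fun _ _ => (0 : V)) = 0 := by
  simp [sumCuts]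

@[simp] lemma sumCutsOf_zero (b : Bool) (F : PlanarForest D) :
    (sumCutsOf b F fun _ _ => (0 : V)) = 0 := by
  simp [sumCutsOf]

/-- The total cut is the only one with an empty trunk. -/
lemma sumCuts_epsilon_trunk (F : PlanarForest D) (f : PlanarForest D → PlanarForest D → V) :
    (sumCuts F fun p t => epsilon t (f p t)) = f F nil := by
  induction F generalizing f with
  | nil => simp
  | cons d C R _ ih =>
    simp only [sumCuts_cons, epsilon_cons, sumCuts_zero, add_zero]
    exact ih fun p t => f (cons d C p) t

/-- The empty cut is the only one with an empty pruned part. -/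
lemma sumCuts_epsilon_pruned (F : PlanarForest D) (f : PlanarForest D → PlanarForest D → V) :
    (sumCuts F fun p t => epsilon p (f p t)) = f nil F := by
  induction F generalizing f with
  | nil => simp
  | cons d C R ihC ihR =>
    simp only [sumCuts_cons, epsilon_cons, sumCuts_zero, zero_add, epsilon_append]
    have h : ∀ e s : PlanarForest D, (sumCuts R fun p t =>
        epsilon e (epsilon p (f (append e p) (cons d s t)))) = epsilon e (f e (cons d s R)) := by
      intro e s
      cases e with
      | nil => simpa using ihR fun p t => f p (cons d s t)
      | cons d' C' R' => simp
    simp only [h]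
    exact ihC fun e s => f e (cons d s R)

lemma sumCutsOf_true_epsilon_pruned (F : PlanarForest D)
    (f : PlanarForest D → PlanarForest D → V) :
    (sumCutsOf true F fun p t => epsilon p (f p t)) = 0 := by
  rw [← sumCutsOf_zero true F]
  exact sumCutsOf_congr fun c hc hb => epsilon_of_ne_nil (pruned_ne_nil_of_cutsLastLeaf hc hb) _

lemma sumCutsOf_false_epsilon_pruned (F : PlanarForest D)
    (f : PlanarForest D → PlanarForest D → V) :
    (sumCutsOf false F fun p t => epsilon p (f p t)) = f nil F := by
  rw [← sumCuts_epsilon_pruned F f, ← sumCutsOf_true_add_false, sumCutsOf_true_epsilon_pruned,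
    zero_add]

lemma sumCutsOf_false_epsilon_trunk {F : PlanarForest D} (hF : F ≠ nil)
    (f : PlanarForest D → PlanarForest D → V) :
    (sumCutsOf false F fun p t => epsilon t (f p t)) = 0 := by
  rw [← sumCutsOf_zero false F]
  exact sumCutsOf_congr fun c hc hb =>
    epsilon_of_ne_nil (trunk_ne_nil_of_not_cutsLastLeaf hF hc hb) _

lemma sumCutsOf_true_epsilon_trunk {F : PlanarForest D} (hF : F ≠ nil)
    (f : PlanarForest D → PlanarForest D → V) :
    (sumCutsOf true F fun p t => epsilon t (f p t)) = f F nil := by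
  rw [← sumCuts_epsilon_trunk F f, ← sumCutsOf_true_add_false, sumCutsOf_false_epsilon_trunk hF,
    add_zero]

end Epsilon

/-! ### Coassociativity of the sums over cuts -/

section Coassoc

variable {D V : Type*} [AddCommGroup V]

/-- Coassociativity of the sum over all cuts: both sides are sums over the pairs of nested cuts,
which decompose `F` into three layers. -/
lemma sumCuts_coassoc (F : PlanarForest D)
    (f : PlanarForest D → PlanarForest D → PlanarForest D → V) :
    (sumCuts F fun p r => sumCuts p fun a b => f a b r) =
      sumCuts F fun a s => sumCuts s fun b r => f a b r := by
  induction F generalizing f with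
  | nil => simp
  | cons d C R ihC ihR =>
    simp only [sumCuts_cons, sumCuts_append, sumCuts_add, add_assoc]
    rw [ihR]
    congr 1
    rw [sumCuts_comm R C]
    congr 1
    · simp only [ihR]
    · calc _ = sumCuts C fun e s => sumCuts e fun u v => sumCuts R fun p r => sumCuts p fun a b =>
            f (append u a) (append v b) (cons d s r) := by simp only [sumCuts_comm R]
        _ = sumCuts C fun u s => sumCuts s fun v w => sumCuts R fun a s => sumCuts s fun b r =>
            f (append u a) (append v b) (cons d w r) := by
          simp only [ihR]
          rw [ihC (fun u v s => sumCuts R fun a s' => sumCuts s' fun b r =>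
            f (append u a) (append v b) (cons d s r))]
        _ = _ := by simp only [sumCuts_comm R]

/-- First axiom of a dendriform coalgebra: the rightmost leaf ends in the leftmost factor. -/
lemma sumCutsOf_coassoc_true_true (F : PlanarForest D)
    (f : PlanarForest D → PlanarForest D → PlanarForest D → V) :
    (sumCutsOf true F fun p r => sumCutsOf true p fun a b => f a b r) =
      sumCutsOf true F fun a s => sumCuts s fun b r => f a b r := by
  induction F generalizing f with
  | nil => simp
  | cons d C R ihC ihR =>
    by_cases hR : R = nil
    · subst hR
      simp only [sumCutsOf_true_graft, sumCuts_cons, sumCuts_nil, sumCutsOf_add, append_nil, ihC,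
        add_assoc]
    · have h1 : ∀ g : PlanarForest D → PlanarForest D → PlanarForest D → V,
          (sumCutsOf true R fun p r => sumCutsOf true (cons d C p) fun a b => g a b r) =
          (sumCutsOf true R fun p r => sumCutsOf true p fun a b => g (cons d C a) b r) +
          sumCutsOf true R fun p r => sumCuts C fun e s => sumCutsOf true p fun a b =>
            g (append e a) (cons d s b) r := fun g => by
        rw [← sumCutsOf_add]
        exact sumCutsOf_congr fun c hc hb =>
          sumCutsOf_cons true d C (pruned_ne_nil_of_cutsLastLeaf hc hb) _
      have h2 : ∀ (e : PlanarForest D) (g : PlanarForest D → PlanarForest D → PlanarForest D → V),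
          (sumCutsOf true R fun p r => sumCutsOf true (append e p) fun a b => g a b r) =
          sumCutsOf true R fun p r => sumCuts e fun u v => sumCutsOf true p fun a b =>
            g (append u a) (append v b) r := fun e g =>
        sumCutsOf_congr fun c hc hb =>
          sumCutsOf_append true e (pruned_ne_nil_of_cutsLastLeaf hc hb) _
      simp only [sumCutsOf_cons _ d C hR, sumCuts_cons, h1, h2, sumCuts_add, sumCutsOf_add,
        add_assoc]
      rw [ihR]
      congr 1
      rw [← sumCuts_swap C]
      congr 1
      · simp only [ihR]
      · simp only [← sumCuts_swap, ihR]
        rw [sumCuts_coassoc C (fun u v s => sumCutsOf true R fun a s' => sumCuts s' fun b r =>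
            f (append u a) (append v b) (cons d s r))]

/-- Second axiom of a dendriform coalgebra: the rightmost leaf ends in the middle factor. -/
lemma sumCutsOf_coassoc_true_false (F : PlanarForest D)
    (f : PlanarForest D → PlanarForest D → PlanarForest D → V) :
    (sumCutsOf true F fun p r => sumCutsOf false p fun a b => f a b r) =
      sumCutsOf false F fun a s => sumCutsOf true s fun b r => f a b r := by
  induction F generalizing f with
  | nil => simp
  | cons d C R ihC ihR =>
    by_cases hR : R = nil
    · subst hR
      simp only [sumCutsOf_true_graft, sumCutsOf_false_graft, sumCutsOf_add, ihC]
    · have h1 : ∀ g : PlanarForest D → PlanarForest D → PlanarForest D → V,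
          (sumCutsOf true R fun p r => sumCutsOf false (cons d C p) fun a b => g a b r) =
          (sumCutsOf true R fun p r => sumCutsOf false p fun a b => g (cons d C a) b r) +
          sumCutsOf true R fun p r => sumCuts C fun e s => sumCutsOf false p fun a b =>
            g (append e a) (cons d s b) r := fun g => by
        rw [← sumCutsOf_add]
        exact sumCutsOf_congr fun c hc hb =>
          sumCutsOf_cons false d C (pruned_ne_nil_of_cutsLastLeaf hc hb) _
      have h2 : ∀ (e : PlanarForest D) (g : PlanarForest D → PlanarForest D → PlanarForest D → V),
          (sumCutsOf true R fun p r => sumCutsOf false (append e p) fun a b => g a b r) =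
          sumCutsOf true R fun p r => sumCuts e fun u v => sumCutsOf false p fun a b =>
            g (append u a) (append v b) r := fun e g =>
        sumCutsOf_congr fun c hc hb =>
          sumCutsOf_append false e (pruned_ne_nil_of_cutsLastLeaf hc hb) _
      have h3 : ∀ (e : PlanarForest D) (g : PlanarForest D → PlanarForest D → PlanarForest D → V),
          (sumCutsOf false R fun a s => sumCutsOf true (cons d e s) fun b r => g a b r) =
          (sumCutsOf false R fun a s => sumCutsOf true s fun b r => g a (cons d e b) r) +
          sumCutsOf false R fun a s => sumCuts e fun u v => sumCutsOf true s fun b r =>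
            g a (append u b) (cons d v r) := fun e g => by
        rw [← sumCutsOf_add]
        exact sumCutsOf_congr fun c hc hb =>
          sumCutsOf_cons true d e (trunk_ne_nil_of_not_cutsLastLeaf hR hc hb) _
      simp only [sumCutsOf_cons _ d C hR, h1, h2, h3, sumCuts_add, add_assoc]
      rw [ihR]
      congr 1
      rw [← sumCuts_swap C]
      congr 1
      · simp only [ihR]
      · simp only [← sumCuts_swap, ihR]
        rw [sumCuts_coassoc C (fun u v s => sumCutsOf false R fun a s' =>
            sumCutsOf true s' fun b r => f (append u a) (append v b) (cons d s r))]

/-- Third axiom of a dendriform coalgebra: the rightmost leaf ends in the rightmost factor. -/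
lemma sumCutsOf_coassoc_false (F : PlanarForest D)
    (f : PlanarForest D → PlanarForest D → PlanarForest D → V) :
    (sumCutsOf false F fun p r => sumCuts p fun a b => f a b r) =
      sumCutsOf false F fun a s => sumCutsOf false s fun b r => f a b r := by
  induction F generalizing f with
  | nil => simp
  | cons d C R ihC ihR =>
    by_cases hR : R = nil
    · subst hR
      simp only [sumCutsOf_false_graft, ihC]
    · have h3 : ∀ (e : PlanarForest D) (g : PlanarForest D → PlanarForest D → PlanarForest D → V),
          (sumCutsOf false R fun a s => sumCutsOf false (cons d e s) fun b r => g a b r) =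
          (sumCutsOf false R fun a s => sumCutsOf false s fun b r => g a (cons d e b) r) +
          sumCutsOf false R fun a s => sumCuts e fun u v => sumCutsOf false s fun b r =>
            g a (append u b) (cons d v r) := fun e g => by
        rw [← sumCutsOf_add]
        exact sumCutsOf_congr fun c hc hb =>
          sumCutsOf_cons false d e (trunk_ne_nil_of_not_cutsLastLeaf hR hc hb) _
      simp only [sumCutsOf_cons _ d C hR, sumCuts_cons, sumCuts_append, h3, sumCuts_add,
        sumCutsOf_add, add_assoc]
      rw [ihR]
      congr 1
      rw [← sumCuts_swap C]
      congr 1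
      · simp only [ihR]
      · simp only [← sumCuts_swap, ihR]
        rw [sumCuts_coassoc C (fun u v s => sumCutsOf false R fun a s' =>
            sumCutsOf false s' fun b r => f (append u a) (append v b) (cons d s r))]

end Coassoc

end PlanarForest

namespace ForestSpace

open PlanarForest

/-! ### Linear extension of maps defined on forests -/

section Extend

variable (K : Type*) {D : Type*} [Field K] {M N : Type*} [AddCommGroup M] [Module K M]
  [AddCommGroup N] [Module K N]

@[simp] lemma ofForest_nil : ofForest K (nil : PlanarForest D) = 0 := rfl

lemma forestBasis_apply (F : {F : PlanarForest D // F ≠ nil}) :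
    forestBasis K D F = ofForest K F.1 := by
  obtain ⟨F, hF⟩ := F
  cases F with
  | nil => exact absurd rfl hF
  | cons d C R => rfl

lemma extend_ofForest (f : PlanarForest D → M) {F : PlanarForest D} (hF : F ≠ nil) :
    extend K f (ofForest K F) = f F := by
  rw [← forestBasis_apply K ⟨F, hF⟩, extend, Module.Basis.constr_basis]

@[simp] lemma extend_ofForest_cons (f : PlanarForest D → M) (d : D) (C R : PlanarForest D) :
    extend K f (ofForest K (cons d C R)) = f (cons d C R) :=
  extend_ofForest K f (cons_ne_nil d C R)

variable {K} in
lemma hom_ext {φ ψ : ForestSpace K D →ₗ[K] M}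
    (h : ∀ F : PlanarForest D, F ≠ nil → φ (ofForest K F) = ψ (ofForest K F)) : φ = ψ := by
  refine (forestBasis K D).ext fun F => ?_
  rw [forestBasis_apply]
  exact h F.1 F.2

@[elab_as_elim]
lemma forest_induction {motive : ForestSpace K D → Prop} (x : ForestSpace K D)
    (forest : ∀ F : PlanarForest D, F ≠ nil → motive (ofForest K F))
    (zero : motive 0) (add : ∀ x y, motive x → motive y → motive (x + y))
    (smul : ∀ (r : K) (x), motive x → motive (r • x)) : motive x := by
  have hx : x ∈ Submodule.span K (Set.range (forestBasis K D)) := by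
    rw [Module.Basis.span_eq]; trivial
  induction hx using Submodule.span_induction with
  | mem x hx =>
    obtain ⟨F, rfl⟩ := hx
    rw [forestBasis_apply]
    exact forest F.1 F.2
  | zero => exact zero
  | add x y _ _ hx hy => exact add x y hx hy
  | smul r x _ hx => exact smul r x hx

lemma extend_congr {f g : PlanarForest D → M} (h : ∀ F, F ≠ nil → f F = g F) :
    extend K f = extend K g :=
  hom_ext fun F hF => by rw [extend_ofForest K f hF, extend_ofForest K g hF, h F hF]

lemma extend_add (f g : PlanarForest D → M) (x : ForestSpace K D) :
    extend K (fun F => f F + g F) x = extend K f x + extend K g x := by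
  rw [← LinearMap.add_apply]
  congr 1
  exact hom_ext fun F hF => by simp [extend_ofForest K _ hF]

lemma extend_sub (f g : PlanarForest D → M) (x : ForestSpace K D) :
    extend K (fun F => f F - g F) x = extend K f x - extend K g x := by
  rw [← LinearMap.sub_apply]
  congr 1
  exact hom_ext fun F hF => by simp [extend_ofForest K _ hF]

@[simp] lemma extend_zero (x : ForestSpace K D) :
    extend K (fun _ : PlanarForest D => (0 : M)) x = 0 := by
  rw [← LinearMap.zero_apply (σ₁₂ := RingHom.id K) x]
  congr 1
  exact hom_ext fun F hF => by simp [extend_ofForest K _ hF]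

lemma map_extend (φ : M →ₗ[K] N) (f : PlanarForest D → M) (x : ForestSpace K D) :
    φ (extend K f x) = extend K (fun F => φ (f F)) x := by
  rw [← LinearMap.comp_apply]
  congr 1
  exact hom_ext fun F hF => by simp [extend_ofForest K _ hF]

lemma extend_extend (g : PlanarForest D → M) {h : PlanarForest D → PlanarForest D}
    (hh : ∀ F, F ≠ nil → h F ≠ nil) (x : ForestSpace K D) :
    extend K g (extend K (fun F => ofForest K (h F)) x) = extend K (fun F => g (h F)) x := by
  rw [map_extend]
  congr 1
  exact extend_congr K fun F hF => extend_ofForest K g (hh F hF)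

lemma extend_linear (φ : ForestSpace K D →ₗ[K] M) (x : ForestSpace K D) :
    extend K (fun F => φ (ofForest K F)) x = φ x := by
  congr 1
  exact hom_ext fun F hF => by simp [extend_ofForest K _ hF]

lemma extend_sumCuts (C : PlanarForest D)
    (f : PlanarForest D → PlanarForest D → PlanarForest D → M) (x : ForestSpace K D) :
    extend K (fun F => sumCuts C (f F)) x = sumCuts C fun e s => extend K (fun F => f F e s) x := by
  unfold sumCuts
  induction C.cuts with
  | nil => simp
  | cons c l ih => simp only [List.map_cons, List.sum_cons, extend_add, ih]

end Extend

end ForestSpace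

namespace ForestSpace

open PlanarForest

/-! ### The dendriform algebra of forests -/

section Products

variable (K : Type*) {D : Type*} [Field K] {M : Type*} [AddCommGroup M] [Module K M]

/-- The right product `F ≻ G` of two forests. -/
noncomputable def succForest (F G : PlanarForest D) : ForestSpace K D :=
  ofForest K (F.append G) - precForest K F G

lemma precForest_cons (d : D) (C R G : PlanarForest D) :
    precForest K (cons d C R) G = ofForest K (cons d (C.append (R.append G)) nil)
      + extend K (fun F => ofForest K (cons d C F)) (precForest K R G)
      - extend K (fun F => ofForest K (cons d (C.append F) nil)) (precForest K R G) := rfl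

@[simp] lemma nil_precForest (G : PlanarForest D) : precForest K nil G = 0 := rfl

@[simp] lemma precForest_nil (F : PlanarForest D) : precForest K F nil = ofForest K F := by
  induction F with
  | nil => rfl
  | cons d C R _ ih =>
    rw [precForest_cons, ih]
    cases R <;> simp

lemma graft_precForest (d : D) (C G : PlanarForest D) :
    precForest K (cons d C nil) G = ofForest K (cons d (C.append G) nil) := by
  simp [precForest_cons]

@[simp] lemma nil_succForest (G : PlanarForest D) : succForest K nil G = ofForest K G := by
  simp [succForest]

@[simp] lemma succForest_nil (F : PlanarForest D) : succForest K F nil = 0 := by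
  simp [succForest]

lemma prec_ofForest {F G : PlanarForest D} (hF : F ≠ nil) (hG : G ≠ nil) :
    (data K D).prec (ofForest K F) (ofForest K G) = precForest K F G := by
  simp only [data, extend₂]
  rw [extend_ofForest K _ hF, extend_ofForest K _ hG]

lemma succ_ofForest {F G : PlanarForest D} (hF : F ≠ nil) (hG : G ≠ nil) :
    (data K D).succ (ofForest K F) (ofForest K G) = succForest K F G := by
  simp only [data, extend₂]
  rw [extend_ofForest K _ hF, extend_ofForest K _ hG]
  rfl

lemma mul_ofForest {F G : PlanarForest D} (hF : F ≠ nil) (hG : G ≠ nil) :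
    (data K D).mul (ofForest K F) (ofForest K G) = ofForest K (F.append G) := by
  simp only [BidendriformData.mul, LinearMap.add_apply, prec_ofForest K hF hG,
    succ_ofForest K hF hG, succForest]
  abel

lemma extend_precForest_cons (d : D) (C R G : PlanarForest D) (g : PlanarForest D → M) :
    extend K g (precForest K (cons d C R) G) = g (cons d (C.append (R.append G)) nil)
      + extend K (fun F => g (cons d C F)) (precForest K R G)
      - extend K (fun F => g (cons d (C.append F) nil)) (precForest K R G) := by
  rw [precForest_cons, map_sub, map_add, extend_ofForest_cons,
    extend_extend K g (fun F _ => cons_ne_nil d C F),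
    extend_extend K g (fun F _ => cons_ne_nil d (C.append F) nil)]

/-- `(F ≺ G) ≺ H = F ≺ (G H)` -/
lemma precForest_precForest (F G H : PlanarForest D) :
    extend K (fun Y => precForest K Y H) (precForest K F G) = precForest K F (G.append H) := by
  induction F with
  | nil => simp
  | cons d C R _ ih =>
    rw [extend_precForest_cons, precForest_cons K d C R (G.append H), ← ih]
    simp only [precForest_cons, extend_sub, extend_add, map_extend, nil_precForest, map_zero,
      append_assoc, nil_append, add_zero, sub_zero]
    abel

/-- `(F G) ≺ H = F ≺ (G H) + F (G ≺ H) - F ≺ (G ≺ H)` -/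
lemma append_precForest (F G H : PlanarForest D) :
    precForest K (F.append G) H = precForest K F (G.append H)
      + extend K (fun Z => ofForest K (F.append Z)) (precForest K G H)
      - extend K (fun Z => precForest K F Z) (precForest K G H) := by
  induction F with
  | nil =>
    simp only [nil_append, nil_precForest, zero_add, extend_zero, sub_zero]
    exact (extend_linear K LinearMap.id _).symm
  | cons d C R _ ih =>
    have h : ∀ g : PlanarForest D → ForestSpace K D, extend K g
        (extend K (fun Z => ofForest K (R.append Z)) (precForest K G H)) =
          extend K (fun Z => g (R.append Z)) (precForest K G H) :=
      fun g => extend_extend K g (fun _ hF => append_ne_nil_right R hF) _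
    simp only [cons_append, precForest_cons, ih, append_assoc, map_add, map_sub, h]
    simp only [map_extend, extend_sub, extend_add]
    abel

/-- The three axioms follow from associativity of concatenation and from the formulas for
`(F ≺ G) ≺ H` and `(F G) ≺ H`. -/
theorem isDendriformAlgebra : (data K D).IsDendriformAlgebra := by
  have key : ∀ F G H : PlanarForest D, F ≠ nil → G ≠ nil → H ≠ nil →
      (data K D).prec ((data K D).mul (ofForest K F) (ofForest K G)) (ofForest K H) =
        (data K D).prec (ofForest K F) ((data K D).mul (ofForest K G) (ofForest K H))
        + (data K D).succ (ofForest K F) ((data K D).prec (ofForest K G) (ofForest K H)) := by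
    intro F G H hF hG hH
    rw [mul_ofForest K hF hG, mul_ofForest K hG hH,
      prec_ofForest K (append_ne_nil_right F hG) hH, prec_ofForest K hF (append_ne_nil_right G hH),
      prec_ofForest K hG hH, append_precForest]
    have h : (data K D).succ (ofForest K F) (precForest K G H) =
        extend K (fun Z => ofForest K (F.append Z)) (precForest K G H)
          - extend K (fun Z => precForest K F Z) (precForest K G H) := by
      rw [← extend_sub]
      simp only [data, extend₂]
      rw [extend_ofForest K _ hF]
    rw [h]
    abel
  have h1 : ∀ F G H : PlanarForest D, F ≠ nil → G ≠ nil → H ≠ nil →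
      (data K D).prec ((data K D).prec (ofForest K F) (ofForest K G)) (ofForest K H) =
        (data K D).prec (ofForest K F) ((data K D).mul (ofForest K G) (ofForest K H)) := by
    intro F G H hF hG hH
    rw [prec_ofForest K hF hG, mul_ofForest K hG hH,
      prec_ofForest K hF (append_ne_nil_right G hH), ← precForest_precForest]
    have h : ((data K D).prec.flip (ofForest K H)) = extend K (fun Y => precForest K Y H) :=
      hom_ext fun Y hY => by
        rw [LinearMap.flip_apply, prec_ofForest K hY hH, extend_ofForest K _ hY]
    rw [← h, LinearMap.flip_apply]
  have h3 : ∀ F G H : PlanarForest D, F ≠ nil → G ≠ nil → H ≠ nil →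
      (data K D).mul ((data K D).mul (ofForest K F) (ofForest K G)) (ofForest K H) =
        (data K D).mul (ofForest K F) ((data K D).mul (ofForest K G) (ofForest K H)) := by
    intro F G H hF hG hH
    rw [mul_ofForest K hF hG, mul_ofForest K hG hH,
      mul_ofForest K (append_ne_nil_right F hG) hH, mul_ofForest K hF (append_ne_nil_right G hH),
      append_assoc]
  -- A trilinear expression vanishes if it does so on forests.
  have ind : ∀ P : ForestSpace K D → ForestSpace K D → ForestSpace K D → ForestSpace K D,
      (∀ b c, IsLinearMap K fun a => P a b c) → (∀ a c, IsLinearMap K fun b => P a b c) →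
      (∀ a b, IsLinearMap K fun c => P a b c) →
      (∀ F G H : PlanarForest D, F ≠ nil → G ≠ nil → H ≠ nil →
        P (ofForest K F) (ofForest K G) (ofForest K H) = 0) → ∀ a b c, P a b c = 0 := by
    intro P h₁ h₂ h₃ h a b c
    induction a using forest_induction with
    | zero => exact (h₁ b c).map_zero
    | add x y hx hy => rw [(h₁ b c).map_add, hx, hy, add_zero]
    | smul r x hx => rw [(h₁ b c).map_smul, hx, smul_zero]
    | forest F hF =>
    induction b using forest_induction with
    | zero => exact (h₂ _ c).map_zero
    | add x y hx hy => rw [(h₂ _ c).map_add, hx, hy, add_zero]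
    | smul r x hx => rw [(h₂ _ c).map_smul, hx, smul_zero]
    | forest G hG =>
    induction c using forest_induction with
    | zero => exact (h₃ _ _).map_zero
    | add x y hx hy => rw [(h₃ _ _).map_add, hx, hy, add_zero]
    | smul r x hx => rw [(h₃ _ _).map_smul, hx, smul_zero]
    | forest H hH => exact h F G H hF hG hH
  let S := data K D
  have A1 : ∀ a b c : ForestSpace K D, S.prec (S.prec a b) c = S.prec a (S.mul b c) := by
    intro a b c
    refine sub_eq_zero.1 (ind (fun a b c => S.prec (S.prec a b) c - S.prec a (S.mul b c))
      (fun b c => ?_) (fun a c => ?_) (fun a b => ?_)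
      (fun F G H hF hG hH => sub_eq_zero.2 (h1 F G H hF hG hH)) a b c) <;>
    constructor <;> intros <;>
    simp only [map_add, map_smul, LinearMap.add_apply, LinearMap.smul_apply, smul_sub] <;> abel
  have A2 : ∀ a b c : ForestSpace K D, S.prec (S.mul a b) c =
      S.prec a (S.mul b c) + S.succ a (S.prec b c) := by
    intro a b c
    refine sub_eq_zero.1 (ind (fun a b c => S.prec (S.mul a b) c -
      (S.prec a (S.mul b c) + S.succ a (S.prec b c)))
      (fun b c => ?_) (fun a c => ?_) (fun a b => ?_)
      (fun F G H hF hG hH => sub_eq_zero.2 (key F G H hF hG hH)) a b c) <;>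
    constructor <;> intros <;>
    simp only [map_add, map_smul, LinearMap.add_apply, LinearMap.smul_apply, smul_sub, smul_add] <;>
    abel
  have A3 : ∀ a b c : ForestSpace K D, S.mul (S.mul a b) c = S.mul a (S.mul b c) := by
    intro a b c
    refine sub_eq_zero.1 (ind (fun a b c => S.mul (S.mul a b) c - S.mul a (S.mul b c))
      (fun b c => ?_) (fun a c => ?_) (fun a b => ?_)
      (fun F G H hF hG hH => sub_eq_zero.2 (h3 F G H hF hG hH)) a b c) <;>
    constructor <;> intros <;>
    simp only [map_add, map_smul, LinearMap.add_apply, LinearMap.smul_apply, smul_sub] <;> abel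
  have m : ∀ x y : ForestSpace K D, S.mul x y = S.prec x y + S.succ x y := fun _ _ => rfl
  have A2' : ∀ a b c : ForestSpace K D, S.prec (S.succ a b) c = S.succ a (S.prec b c) := by
    intro a b c
    have h := A2 a b c
    rw [m a b, map_add, LinearMap.add_apply, A1] at h
    exact add_left_cancel h
  refine ⟨A1, A2', fun a b c => ?_⟩
  have h := A3 a b c
  have h2 : S.succ a (S.mul b c) = S.succ a (S.prec b c) + S.succ a (S.succ b c) := by
    rw [m b c, map_add]
  rw [m (S.mul a b) c, A2, m a (S.mul b c), h2, add_assoc] at h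
  exact add_left_cancel (add_left_cancel h)

end Products

end ForestSpace

namespace ForestSpace

open PlanarForest

/-! ### The dendriform coalgebra of forests -/

section Coproducts

variable (K : Type*) {D : Type*} [Field K] {M : Type*} [AddCommGroup M] [Module K M]

section Tmul

variable {N : Type*} [AddCommGroup N] [Module K N]

lemma sumCutsOf_tmul (b : Bool) (F : PlanarForest D) (f : PlanarForest D → PlanarForest D → M)
    (y : N) : sumCutsOf b F f ⊗ₜ[K] y = sumCutsOf b F fun p t => f p t ⊗ₜ[K] y :=
  map_sumCutsOf ((TensorProduct.mk K M N).flip y) b F f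

lemma tmul_sumCutsOf (b : Bool) (F : PlanarForest D) (f : PlanarForest D → PlanarForest D → M)
    (y : N) : y ⊗ₜ[K] sumCutsOf b F f = sumCutsOf b F fun p t => y ⊗ₜ[K] f p t :=
  map_sumCutsOf (TensorProduct.mk K N M y) b F f

lemma sumCuts_tmul (F : PlanarForest D) (f : PlanarForest D → PlanarForest D → M)
    (y : N) : sumCuts F f ⊗ₜ[K] y = sumCuts F fun p t => f p t ⊗ₜ[K] y :=
  map_sumCuts ((TensorProduct.mk K M N).flip y) F f

lemma tmul_sumCuts (F : PlanarForest D) (f : PlanarForest D → PlanarForest D → M)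
    (y : N) : y ⊗ₜ[K] sumCuts F f = sumCuts F fun p t => y ⊗ₜ[K] f p t :=
  map_sumCuts (TensorProduct.mk K N M y) F f

end Tmul

lemma cutSum_eq (b : Bool) (F : PlanarForest D) :
    cutSum K b F = sumCutsOf b F fun p t => ofForest K p ⊗ₜ[K] ofForest K t := by
  simp only [cutSum, sumCutsOf]
  induction F.cuts with
  | nil => rfl
  | cons c l ih =>
    by_cases h : c.cutsLastLeaf = b
    · simp [h, ih]
    · simp [h, ih]

/-- The formula for `Δ_≺` on a forest, which may be empty. -/
lemma coprec_ofForest (F : PlanarForest D) : (data K D).coprec (ofForest K F) =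
    sumCutsOf true F fun p t => ofForest K p ⊗ₜ[K] ofForest K t := by
  cases F with
  | nil => simp
  | cons d C R => rw [← cutSum_eq]; simp only [data]; rw [extend_ofForest_cons]

/-- The formula for `Δ_≻` on a forest, which may be empty. -/
lemma cosucc_ofForest (F : PlanarForest D) : (data K D).cosucc (ofForest K F) =
    sumCutsOf false F fun p t => ofForest K p ⊗ₜ[K] ofForest K t := by
  cases F with
  | nil => simp
  | cons d C R => rw [← cutSum_eq]; simp only [data]; rw [extend_ofForest_cons]

/-- The formula for `Δ_≺ + Δ_≻` on a forest, which may be empty. -/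
lemma comul_ofForest (F : PlanarForest D) : (data K D).comul (ofForest K F) =
    sumCuts F fun p t => ofForest K p ⊗ₜ[K] ofForest K t := by
  rw [BidendriformData.comul, LinearMap.add_apply, coprec_ofForest, cosucc_ofForest,
    sumCutsOf_true_add_false]

theorem isDendriformCoalgebra : (data K D).IsDendriformCoalgebra := by
  constructor
  · intro a
    induction a using forest_induction with
    | zero => simp
    | add x y hx hy => simp only [map_add, hx, hy]; abel
    | smul r x hx => simp only [map_smul, hx, smul_add]
    | forest F hF =>
      rw [← LinearMap.add_apply, ← LinearMap.lTensor_add]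
      change _ = (data K D).comul.lTensor _ _
      simp only [coprec_ofForest, map_sumCutsOf, LinearMap.rTensor_tmul, LinearMap.lTensor_tmul,
        comul_ofForest]
      simp only [sumCutsOf_tmul, tmul_sumCuts, map_sumCutsOf, TensorProduct.assoc_tmul]
      exact sumCutsOf_coassoc_true_true F
        fun a b r => ofForest K a ⊗ₜ[K] (ofForest K b ⊗ₜ[K] ofForest K r)
  · intro a
    induction a using forest_induction with
    | zero => simp
    | add x y hx hy => simp only [map_add, hx, hy]
    | smul r x hx => simp only [map_smul, hx]
    | forest F hF =>
      simp only [coprec_ofForest, cosucc_ofForest, map_sumCutsOf, LinearMap.rTensor_tmul,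
        LinearMap.lTensor_tmul]
      simp only [sumCutsOf_tmul, tmul_sumCutsOf, map_sumCutsOf, TensorProduct.assoc_tmul]
      exact sumCutsOf_coassoc_true_false F
        fun a b r => ofForest K a ⊗ₜ[K] (ofForest K b ⊗ₜ[K] ofForest K r)
  · intro a
    induction a using forest_induction with
    | zero => simp
    | add x y hx hy => simp only [map_add] at hx hy ⊢; rw [← hx, ← hy]; abel
    | smul r x hx => simp only [map_smul, map_add, ← smul_add] at hx ⊢; rw [hx]
    | forest F hF =>
      rw [← LinearMap.add_apply, ← LinearMap.rTensor_add]
      change TensorProduct.assoc K _ _ _ ((data K D).comul.rTensor _ _) = _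
      simp only [cosucc_ofForest, map_sumCutsOf, LinearMap.rTensor_tmul, LinearMap.lTensor_tmul,
        comul_ofForest]
      simp only [sumCuts_tmul, tmul_sumCutsOf, map_sumCuts, TensorProduct.assoc_tmul]
      exact sumCutsOf_coassoc_false F
        fun a b r => ofForest K a ⊗ₜ[K] (ofForest K b ⊗ₜ[K] ofForest K r)

lemma sumCutsOf_graft (b : Bool) (d : D) (C : PlanarForest D)
    (f : PlanarForest D → PlanarForest D → M) :
    sumCutsOf b (cons d C nil) f = (bif b then f (cons d C nil) nil else 0) +
      sumCutsOf b C fun p t => f p (cons d t nil) := by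
  cases b
  · simp [sumCutsOf_false_graft]
  · simp [sumCutsOf_true_graft]

lemma extend_sumCutsOf_graft (b : Bool) (d : D) (C : PlanarForest D)
    (f : PlanarForest D → PlanarForest D → M) (x : ForestSpace K D) :
    extend K (fun Y => sumCutsOf b (cons d (C.append Y) nil) f) x =
      (bif b then extend K (fun Y => f (cons d (C.append Y) nil) nil) x else 0) +
      sumCuts C fun e s => extend K (fun Y => sumCutsOf b Y fun p t =>
        f (e.append p) (cons d (s.append t) nil)) x := by
  rw [← extend_sumCuts]
  cases b <;> simp only [cond_true, cond_false, zero_add, ← extend_add] <;>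
  · congr 1
    refine extend_congr K fun Y hY => ?_
    rw [sumCutsOf_graft, sumCutsOf_append _ C hY]
    simp

lemma extend_sumCutsOf_cons (b : Bool) (d : D) (C : PlanarForest D)
    (f : PlanarForest D → PlanarForest D → M) (x : ForestSpace K D) :
    extend K (fun Y => sumCutsOf b (cons d C Y) f) x =
      extend K (fun Y => sumCutsOf b Y fun p t => f (cons d C p) t) x +
      sumCuts C fun e s => extend K (fun Y => sumCutsOf b Y fun p t =>
        f (e.append p) (cons d s t)) x := by
  rw [← extend_sumCuts, ← extend_add]
  congr 1
  exact extend_congr K fun Y hY => sumCutsOf_cons b d C hY f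

/-- The coproducts of `F ≺ G`, with the counital terms: the cuts of `F ≺ G` are obtained by
cutting `F` and `G`, concatenating what is cut off and taking the left product of what remains.
The linear extension makes it possible to evaluate an arbitrary function `f` of the two parts. The
first term on the right is `(F ≺ G) ⊗ 1`. -/
lemma sumCutsOf_precForest (b : Bool) (F : PlanarForest D) {G : PlanarForest D} (hG : G ≠ nil)
    (f : PlanarForest D → PlanarForest D → M) :
    extend K (fun Y => sumCutsOf b Y f) (precForest K F G) =
      (bif b then extend K (fun Y => f Y nil) (precForest K F G) else 0) +
      sumCuts F fun p t => sumCutsOf b G fun q s =>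
        extend K (fun Z => f (p.append q) Z) (precForest K t s) := by
  induction F generalizing f with
  | nil => cases b <;> simp
  | cons d C R _ ih =>
    have hsub : ∀ g h : PlanarForest D → PlanarForest D → M, (sumCuts C fun p t =>
        g p t - h p t) = sumCuts C g - sumCuts C h := fun g h => by
      rw [eq_sub_iff_add_eq, ← sumCuts_add]; simp
    have hsub' : ∀ g h : PlanarForest D → PlanarForest D → M, (sumCuts R fun p t =>
        g p t - h p t) = sumCuts R g - sumCuts R h := fun g h => by
      rw [eq_sub_iff_add_eq, ← sumCuts_add]; simp
    have hsub'' : ∀ g h : PlanarForest D → PlanarForest D → M, (sumCutsOf b G fun p t =>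
        g p t - h p t) = sumCutsOf b G g - sumCutsOf b G h := fun g h => by
      rw [eq_sub_iff_add_eq, ← sumCutsOf_add]; simp
    rw [extend_precForest_cons, extend_sumCutsOf_cons, extend_sumCutsOf_graft, sumCutsOf_graft,
      sumCutsOf_append b C (append_ne_nil_right R hG)]
    simp only [sumCutsOf_append b R hG, ih, sumCuts_cons, extend_precForest_cons, sumCuts_add,
      sumCutsOf_add, hsub, hsub', hsub'', append_assoc, append_nil, cons_append]
    cases b <;> simp only [cond_true, cond_false, sumCuts_zero] <;> abel

/-- The product of two forests in terms of the product of the augmentation ideal. -/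
lemma ofForest_append (F G : PlanarForest D) : ofForest K (F.append G) =
    (data K D).mul (ofForest K F) (ofForest K G) + epsilon F (ofForest K G)
      + epsilon G (ofForest K F) := by
  cases F with
  | nil => cases G <;> simp
  | cons d C R =>
    cases G with
    | nil => simp
    | cons d' C' R' => rw [mul_ofForest] <;> simp

lemma precForest_eq (F G : PlanarForest D) : precForest K F G =
    (data K D).prec (ofForest K F) (ofForest K G) + epsilon G (ofForest K F) := by
  cases F with
  | nil => simp
  | cons d C R =>
    cases G with
    | nil => simp
    | cons d' C' R' => rw [prec_ofForest] <;> simp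

lemma succForest_eq (F G : PlanarForest D) : succForest K F G =
    (data K D).succ (ofForest K F) (ofForest K G) + epsilon F (ofForest K G) := by
  cases F with
  | nil => simp
  | cons d C R =>
    cases G with
    | nil => simp
    | cons d' C' R' => rw [succ_ofForest] <;> simp

end Coproducts

end ForestSpace

namespace ForestSpace

open PlanarForest

/-! ### The bidendriform bialgebra of forests -/

section Bialgebra

variable (K : Type*) {D : Type*} [Field K] {M : Type*} [AddCommGroup M] [Module K M]

lemma extend_tmul (x : M) (y : ForestSpace K D) :
    extend K (fun Z => x ⊗ₜ[K] ofForest K Z) y = x ⊗ₜ[K] y :=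
  extend_linear K (TensorProduct.mk K M (ForestSpace K D) x) y

lemma coprec_precForest (F : PlanarForest D) {G : PlanarForest D} (hG : G ≠ nil) :
    (data K D).coprec (precForest K F G) = sumCuts F fun p t => sumCutsOf true G fun q s =>
      ofForest K (p.append q) ⊗ₜ[K] precForest K t s := by
  rw [← extend_linear]
  simp only [coprec_ofForest]
  rw [sumCutsOf_precForest K true F hG]
  simp only [ofForest_nil, TensorProduct.tmul_zero, extend_zero, cond_true, zero_add]
  simp only [extend_tmul]

lemma cosucc_precForest (F : PlanarForest D) {G : PlanarForest D} (hG : G ≠ nil) :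
    (data K D).cosucc (precForest K F G) = sumCuts F fun p t => sumCutsOf false G fun q s =>
      ofForest K (p.append q) ⊗ₜ[K] precForest K t s := by
  rw [← extend_linear]
  simp only [cosucc_ofForest]
  rw [sumCutsOf_precForest K false F hG]
  simp only [cond_false, zero_add]
  simp only [extend_tmul]

lemma sumCuts_sumCutsOf_sub (b : Bool) (F G : PlanarForest D)
    (f g : PlanarForest D → PlanarForest D → PlanarForest D → PlanarForest D → M) :
    (sumCuts F fun p t => sumCutsOf b G fun q s => f p t q s - g p t q s) =
      (sumCuts F fun p t => sumCutsOf b G fun q s => f p t q s) -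
      sumCuts F fun p t => sumCutsOf b G fun q s => g p t q s := by
  rw [eq_sub_iff_add_eq]
  simp only [← sumCuts_add, ← sumCutsOf_add, sub_add_cancel]

lemma coprec_succForest (F : PlanarForest D) {G : PlanarForest D} (hG : G ≠ nil) :
    (data K D).coprec (succForest K F G) = sumCuts F fun p t => sumCutsOf true G fun q s =>
      ofForest K (p.append q) ⊗ₜ[K] succForest K t s := by
  simp only [succForest, map_sub, TensorProduct.tmul_sub, sumCuts_sumCutsOf_sub]
  rw [coprec_precForest K F hG, coprec_ofForest, sumCutsOf_append true F hG]

lemma cosucc_succForest (F : PlanarForest D) {G : PlanarForest D} (hG : G ≠ nil) :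
    (data K D).cosucc (succForest K F G) = sumCuts F fun p t => sumCutsOf false G fun q s =>
      ofForest K (p.append q) ⊗ₜ[K] succForest K t s := by
  simp only [succForest, map_sub, TensorProduct.tmul_sub, sumCuts_sumCutsOf_sub]
  rw [cosucc_precForest K F hG, cosucc_ofForest, sumCutsOf_append false F hG]

lemma epsilon_tmul (F : PlanarForest D) {N : Type*} [AddCommGroup N] [Module K N] (x : M) (y : N) :
    epsilon F x ⊗ₜ[K] y = epsilon F (x ⊗ₜ[K] y) := by
  cases F <;> simp

lemma tmul_epsilon (F : PlanarForest D) {N : Type*} [AddCommGroup N] [Module K N] (x : M) (y : N) :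
    x ⊗ₜ[K] epsilon F y = epsilon F (x ⊗ₜ[K] y) := by
  cases F <;> simp

lemma sumCutsOf_epsilon (b : Bool) (F G : PlanarForest D)
    (f : PlanarForest D → PlanarForest D → M) :
    (sumCutsOf b G fun q s => epsilon F (f q s)) = epsilon F (sumCutsOf b G f) := by
  cases F <;> simp

lemma map₂_sum (φ ψ : ForestSpace K D →ₗ[K] ForestSpace K D →ₗ[K] ForestSpace K D) (b : Bool)
    (F G : PlanarForest D) :
    TensorProduct.map₂ φ ψ (sumCuts F fun p t => ofForest K p ⊗ₜ[K] ofForest K t)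
      (sumCutsOf b G fun q s => ofForest K q ⊗ₜ[K] ofForest K s) =
    sumCuts F fun p t => sumCutsOf b G fun q s =>
      φ (ofForest K p) (ofForest K q) ⊗ₜ[K] ψ (ofForest K t) (ofForest K s) := by
  rw [map_sumCutsOf]
  have h : ∀ y, TensorProduct.map₂ φ ψ (sumCuts F fun p t => ofForest K p ⊗ₜ[K] ofForest K t) y =
      sumCuts F fun p t => TensorProduct.map₂ φ ψ (ofForest K p ⊗ₜ[K] ofForest K t) y :=
    fun y => map_sumCuts ((TensorProduct.map₂ φ ψ).flip y) F _
  simp only [h, ← sumCuts_swap, TensorProduct.map₂_apply_tmul, TensorProduct.map_tmul]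

/-- The compatibilities of the products with the coproducts are read off from the formulas for the
coproducts of `F ≺ G` and `F ≻ G`: in these sums over pairs of cuts the products of forests and the
operations with an empty forest produce terms with `epsilon`, which select the empty or the total
cut of `F` or `G`. -/
theorem isBialgebra : (data K D).IsBialgebra := by
  refine ⟨isDendriformAlgebra K, isDendriformCoalgebra K, fun a b => ?_, fun a b => ?_,
    fun a b => ?_, fun a b => ?_⟩
  all_goals
    induction a using forest_induction with
    | zero => simp
    | add x y hx hy =>
      simp only [map_add, LinearMap.add_apply, hx, hy, LinearMap.lTensor_add,
        LinearMap.rTensor_add, TensorProduct.add_tmul, TensorProduct.tmul_add]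
      abel
    | smul r x hx =>
      simp only [map_smul, LinearMap.smul_apply, hx, LinearMap.lTensor_smul,
        LinearMap.rTensor_smul, TensorProduct.smul_tmul', TensorProduct.tmul_smul, smul_add]
    | forest F hF => ?_
  all_goals
    induction b using forest_induction with
    | zero => simp
    | add x y hx hy =>
      simp only [map_add, LinearMap.add_apply, hx, hy, LinearMap.lTensor_add,
        LinearMap.rTensor_add, TensorProduct.add_tmul, TensorProduct.tmul_add]
      abel
    | smul r x hx =>
      simp only [map_smul, LinearMap.smul_apply, hx, LinearMap.lTensor_smul,
        LinearMap.rTensor_smul, TensorProduct.smul_tmul', TensorProduct.tmul_smul, smul_add]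
    | forest G hG => ?_
  · rw [succ_ofForest K hF hG, cosucc_succForest K F hG, comul_ofForest, cosucc_ofForest,
      map₂_sum]
    simp only [ofForest_append, succForest_eq, TensorProduct.add_tmul, TensorProduct.tmul_add,
      epsilon_tmul, tmul_epsilon, sumCuts_add, sumCutsOf_add, map_sumCuts, map_sumCutsOf,
      sumCutsOf_epsilon, sumCuts_epsilon_pruned, sumCutsOf_false_epsilon_pruned,
      LinearMap.lTensor_tmul, LinearMap.rTensor_tmul, LinearMap.flip_apply,
      sumCuts_epsilon_trunk, epsilon_of_ne_nil hF]
    abel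
  · rw [prec_ofForest K hF hG, cosucc_precForest K F hG, comul_ofForest, cosucc_ofForest,
      map₂_sum]
    simp only [ofForest_append, precForest_eq, TensorProduct.add_tmul, TensorProduct.tmul_add,
      epsilon_tmul, tmul_epsilon, sumCuts_add, sumCutsOf_add, map_sumCuts, map_sumCutsOf,
      sumCutsOf_epsilon, sumCuts_epsilon_pruned, sumCutsOf_false_epsilon_pruned,
      LinearMap.lTensor_tmul, LinearMap.flip_apply, sumCutsOf_false_epsilon_trunk hG, sumCuts_zero]
    abel
  · rw [succ_ofForest K hF hG, coprec_succForest K F hG, comul_ofForest, coprec_ofForest,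
      map₂_sum]
    simp only [ofForest_append, succForest_eq, TensorProduct.add_tmul, TensorProduct.tmul_add,
      epsilon_tmul, tmul_epsilon, sumCuts_add, sumCutsOf_add, map_sumCutsOf,
      sumCutsOf_epsilon, sumCuts_epsilon_pruned, sumCutsOf_true_epsilon_pruned,
      LinearMap.lTensor_tmul, LinearMap.rTensor_tmul, sumCuts_epsilon_trunk, sumCuts_zero,
      epsilon_of_ne_nil hF]
    abel
  · rw [prec_ofForest K hF hG, coprec_precForest K F hG, comul_ofForest, coprec_ofForest,
      map₂_sum]
    simp only [ofForest_append, precForest_eq, TensorProduct.add_tmul, TensorProduct.tmul_add,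
      epsilon_tmul, tmul_epsilon, sumCuts_add, sumCutsOf_add, map_sumCuts, map_sumCutsOf,
      sumCutsOf_epsilon, sumCuts_epsilon_pruned, sumCutsOf_true_epsilon_pruned,
      LinearMap.lTensor_tmul, LinearMap.rTensor_tmul, LinearMap.flip_apply,
      sumCutsOf_true_epsilon_trunk hG, sumCuts_zero, epsilon_of_ne_nil hG]
    abel

end Bialgebra

end ForestSpace

namespace BidendriformData

/-! ### The projections onto the kernels of the coproducts -/

section Projections

variable {K A : Type*} [Field K] [AddCommGroup A] [Module K A] (S : BidendriformData K A)

/-- Truncations of the projection `E` of `A` onto `Ker Δ_≺` which is given by the recursion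
`E a = a - a''_≺ · E a'_≺`, unrolled `n` times starting from `0`. -/
noncomputable def leftProj : ℕ → A →ₗ[K] A
  | 0 => 0
  | n + 1 => LinearMap.id -
      TensorProduct.lift S.mul.flip ∘ₗ (leftProj n).rTensor A ∘ₗ S.coprec

/-- Truncations of the projection `F` of `A` onto `Ker Δ_≻` which is given by the recursion
`F a = a - a'_≻ ≻ F a''_≻`, unrolled `n` times starting from `0`. -/
noncomputable def rightProj : ℕ → A →ₗ[K] A
  | 0 => 0
  | n + 1 => LinearMap.id -
      TensorProduct.lift S.succ ∘ₗ (rightProj n).lTensor A ∘ₗ S.cosucc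

lemma leftProj_succ_apply (n : ℕ) (a : A) : S.leftProj (n + 1) a =
    a - TensorProduct.lift S.mul.flip ((S.leftProj n).rTensor A (S.coprec a)) := rfl

lemma rightProj_succ_apply (n : ℕ) (a : A) : S.rightProj (n + 1) a =
    a - TensorProduct.lift S.succ ((S.rightProj n).lTensor A (S.cosucc a)) := rfl

/-- The elements killed by `n` successive applications of `Δ_≺` to the leftmost factor. -/
noncomputable def coprecFil : ℕ → Submodule K A
  | 0 => ⊥
  | n + 1 => (LinearMap.range ((coprecFil n).subtype.rTensor A)).comap S.coprec

/-- The elements killed by `n` successive applications of `Δ_≻` to the rightmost factor. -/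
noncomputable def cosuccFil : ℕ → Submodule K A
  | 0 => ⊥
  | n + 1 => (LinearMap.range ((cosuccFil n).subtype.lTensor A)).comap S.cosucc

variable {S}

lemma mul_apply (a b : A) : S.mul a b = S.prec a b + S.succ a b := rfl

lemma leftProj_of_coprec_eq_zero {a : A} (h : S.coprec a = 0) (n : ℕ) :
    S.leftProj (n + 1) a = a := by
  simp [leftProj_succ_apply, h]

lemma rightProj_of_cosucc_eq_zero {a : A} (h : S.cosucc a = 0) (n : ℕ) :
    S.rightProj (n + 1) a = a := by
  simp [rightProj_succ_apply, h]

lemma IsBialgebra.coprec_succ_of_coprec_eq_zero (hS : S.IsBialgebra) (a : A) {u : A}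
    (hu : S.coprec u = 0) : S.coprec (S.succ a u) = 0 := by
  simp [hS.coprec_succ, hu]

/-- `Δ_≺(a u) = u ⊗ a + a' u ⊗ a''` for `u ∈ Ker Δ_≺`. -/
lemma IsBialgebra.coprec_mul_of_coprec_eq_zero (hS : S.IsBialgebra) (a : A) {u : A}
    (hu : S.coprec u = 0) :
    S.coprec (S.mul a u) = u ⊗ₜ[K] a + (S.mul.flip u).rTensor A (S.comul a) := by
  rw [mul_apply, map_add, hS.coprec_succ_of_coprec_eq_zero a hu, hS.coprec_prec, hu]
  simp [add_comm]

/-- `Δ_≻(a ≻ v) = a ⊗ v + a' ⊗ a'' ≻ v` for `v ∈ Ker Δ_≻`. -/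
lemma IsBialgebra.cosucc_succ_of_cosucc_eq_zero (hS : S.IsBialgebra) (a : A) {v : A}
    (hv : S.cosucc v = 0) :
    S.cosucc (S.succ a v) = a ⊗ₜ[K] v + (S.succ.flip v).lTensor A (S.comul a) := by
  rw [hS.cosucc_succ, hv]
  simp [add_comm]

lemma IsBialgebra.comul_coprec (hS : S.IsBialgebra) (a : A) :
    S.comul.lTensor A (S.coprec a) =
      TensorProduct.assoc K A A A (S.coprec.rTensor A (S.coprec a)) := by
  rw [hS.coalgebra.coprec_coprec, comul, LinearMap.lTensor_add, LinearMap.add_apply]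

lemma IsBialgebra.comul_cosucc (hS : S.IsBialgebra) (a : A) :
    TensorProduct.assoc K A A A (S.comul.rTensor A (S.cosucc a)) =
      S.cosucc.lTensor A (S.cosucc a) := by
  rw [← hS.coalgebra.cosucc_cosucc, comul, LinearMap.rTensor_add, LinearMap.add_apply]

/-- The truncated projections stabilize on `coprecFil`, and take their values in `Ker Δ_≺`. -/
lemma IsBialgebra.leftProj_spec (hS : S.IsBialgebra) (n : ℕ) : ∀ a ∈ S.coprecFil n,
    S.coprec (S.leftProj n a) = 0 ∧ S.leftProj (n + 1) a = S.leftProj n a := by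
  induction n with
  | zero =>
    intro a ha
    obtain rfl : a = 0 := ha
    simp
  | succ n ih =>
    intro a ha
    obtain ⟨z, hz⟩ : S.coprec a ∈ LinearMap.range ((S.coprecFil n).subtype.rTensor A) := ha
    have hst : (S.leftProj (n + 1)).rTensor A (S.coprec a) =
        (S.leftProj n).rTensor A (S.coprec a) := by
      have h : S.leftProj (n + 1) ∘ₗ (S.coprecFil n).subtype =
          S.leftProj n ∘ₗ (S.coprecFil n).subtype :=
        LinearMap.ext fun x => (ih x x.2).2
      rw [← hz, ← LinearMap.rTensor_comp_apply, ← LinearMap.rTensor_comp_apply, h]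
    refine ⟨?_, by rw [leftProj_succ_apply, hst, ← leftProj_succ_apply]⟩
    -- `Θ (u ⊗ (s ⊗ t)) = s · E u ⊗ t`
    let Θ : A ⊗[K] (A ⊗[K] A) →ₗ[K] A ⊗[K] A :=
      (TensorProduct.lift S.mul.flip ∘ₗ (S.leftProj n).rTensor A).rTensor A ∘ₗ
        (TensorProduct.assoc K A A A).symm.toLinearMap
    have hΘ : ∀ (u : A) (y : A ⊗[K] A),
        Θ (u ⊗ₜ y) = (S.mul.flip (S.leftProj n u)).rTensor A y := fun u y => by
      induction y with
      | zero => simp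
      | add y y' h h' => rw [TensorProduct.tmul_add, map_add, h, h', map_add]
      | tmul s t => simp [Θ]
    have key : S.coprec (TensorProduct.lift S.mul.flip
        ((S.leftProj n).rTensor A (S.coprec a))) =
        (S.leftProj n).rTensor A (S.coprec a) + Θ (S.comul.lTensor A (S.coprec a)) := by
      rw [← hz]
      clear hz
      induction z with
      | zero => simp
      | add y y' h h' => simp only [map_add, h, h']; abel
      | tmul x y =>
        simp only [LinearMap.rTensor_tmul, LinearMap.lTensor_tmul, TensorProduct.lift.tmul,
          LinearMap.flip_apply, hΘ, Submodule.subtype_apply]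
        exact hS.coprec_mul_of_coprec_eq_zero y (ih x x.2).1
    have hlast : Θ (S.comul.lTensor A (S.coprec a)) =
        S.coprec a - (S.leftProj n).rTensor A (S.coprec a) := by
      rw [hS.comul_coprec, ← hst]
      have h : TensorProduct.lift S.mul.flip ∘ₗ (S.leftProj n).rTensor A ∘ₗ S.coprec =
          LinearMap.id - S.leftProj (n + 1) := by
        rw [leftProj, sub_sub_cancel]
      simp only [Θ, LinearMap.comp_apply, LinearEquiv.coe_coe, LinearEquiv.symm_apply_apply]
      rw [← LinearMap.rTensor_comp_apply, LinearMap.comp_assoc, h, LinearMap.rTensor_sub,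
        LinearMap.sub_apply, LinearMap.rTensor_id_apply]
    rw [leftProj_succ_apply, map_sub, key, hlast]
    abel

/-- The truncated projections stabilize on `cosuccFil`, and take their values in `Ker Δ_≻`. -/
lemma IsBialgebra.rightProj_spec (hS : S.IsBialgebra) (n : ℕ) : ∀ a ∈ S.cosuccFil n,
    S.cosucc (S.rightProj n a) = 0 ∧ S.rightProj (n + 1) a = S.rightProj n a := by
  induction n with
  | zero =>
    intro a ha
    obtain rfl : a = 0 := ha
    simp
  | succ n ih =>
    intro a ha
    obtain ⟨z, hz⟩ : S.cosucc a ∈ LinearMap.range ((S.cosuccFil n).subtype.lTensor A) := ha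
    have hst : (S.rightProj (n + 1)).lTensor A (S.cosucc a) =
        (S.rightProj n).lTensor A (S.cosucc a) := by
      have h : S.rightProj (n + 1) ∘ₗ (S.cosuccFil n).subtype =
          S.rightProj n ∘ₗ (S.cosuccFil n).subtype :=
        LinearMap.ext fun x => (ih x x.2).2
      rw [← hz, ← LinearMap.lTensor_comp_apply, ← LinearMap.lTensor_comp_apply, h]
    refine ⟨?_, by rw [rightProj_succ_apply, hst, ← rightProj_succ_apply]⟩
    -- `Θ ((s ⊗ t) ⊗ v) = s ⊗ t ≻ F v`
    let Θ : (A ⊗[K] A) ⊗[K] A →ₗ[K] A ⊗[K] A :=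
      (TensorProduct.lift S.succ ∘ₗ (S.rightProj n).lTensor A).lTensor A ∘ₗ
        (TensorProduct.assoc K A A A).toLinearMap
    have hΘ : ∀ (v : A) (y : A ⊗[K] A),
        Θ (y ⊗ₜ v) = (S.succ.flip (S.rightProj n v)).lTensor A y := fun v y => by
      induction y with
      | zero => simp
      | add y y' h h' => rw [TensorProduct.add_tmul, map_add, h, h', map_add]
      | tmul s t => simp [Θ]
    have key : S.cosucc (TensorProduct.lift S.succ
        ((S.rightProj n).lTensor A (S.cosucc a))) =
        (S.rightProj n).lTensor A (S.cosucc a) + Θ (S.comul.rTensor A (S.cosucc a)) := by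
      rw [← hz]
      clear hz
      induction z with
      | zero => simp
      | add y y' h h' => simp only [map_add, h, h']; abel
      | tmul y x =>
        simp only [LinearMap.rTensor_tmul, LinearMap.lTensor_tmul, TensorProduct.lift.tmul,
          hΘ, Submodule.subtype_apply]
        exact hS.cosucc_succ_of_cosucc_eq_zero y (ih x x.2).1
    have hlast : Θ (S.comul.rTensor A (S.cosucc a)) =
        S.cosucc a - (S.rightProj n).lTensor A (S.cosucc a) := by
      have h : TensorProduct.lift S.succ ∘ₗ (S.rightProj n).lTensor A ∘ₗ S.cosucc =
          LinearMap.id - S.rightProj (n + 1) := by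
        rw [rightProj, sub_sub_cancel]
      simp only [Θ, LinearMap.comp_apply, LinearEquiv.coe_coe]
      rw [hS.comul_cosucc, ← hst, ← LinearMap.lTensor_comp_apply, LinearMap.comp_assoc, h,
        LinearMap.lTensor_sub, LinearMap.sub_apply, LinearMap.lTensor_id_apply]
    rw [rightProj_succ_apply, map_sub, key, hlast]
    abel

end Projections

end BidendriformData

namespace BidendriformData

/-! ### Subspaces of tensor products -/

section Tensor

variable {K A B C : Type*} [Field K] [AddCommGroup A] [Module K A] [AddCommGroup B] [Module K B]
  [AddCommGroup C] [Module K C]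

lemma mem_range_lTensor_ker {f : A →ₗ[K] B} {x : C ⊗[K] A} (h : f.lTensor C x = 0) :
    x ∈ LinearMap.range ((LinearMap.ker f).subtype.lTensor C) :=
  (Module.Flat.lTensor_exact C (LinearMap.exact_subtype_ker_map f) x).1 h

lemma mem_range_rTensor_ker {f : A →ₗ[K] B} {x : A ⊗[K] C} (h : f.rTensor C x = 0) :
    x ∈ LinearMap.range ((LinearMap.ker f).subtype.rTensor C) :=
  (Module.Flat.rTensor_exact C (LinearMap.exact_subtype_ker_map f) x).1 h

/-- Linear forms on the right factor separate the elements of a tensor product. -/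
lemma eq_zero_of_forall_lTensor {x : A ⊗[K] B}
    (h : ∀ φ : B →ₗ[K] K, TensorProduct.rid K A (φ.lTensor A x) = 0) : x = 0 := by
  classical
  let b := Module.Basis.ofVectorSpace K B
  refine (TensorProduct.equivFinsuppOfBasisRight b).map_eq_zero_iff.1 (Finsupp.ext fun i => ?_)
  have hi : ∀ y : A ⊗[K] B, TensorProduct.equivFinsuppOfBasisRight b y i =
      TensorProduct.rid K A ((b.coord i).lTensor A y) := fun y => by
    induction y with
    | zero => simp
    | add y y' h h' => simp only [map_add, Finsupp.add_apply, h, h']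
    | tmul s t => simp [TensorProduct.equivFinsuppOfBasisRight_apply_tmul]
  rw [hi, h]
  rfl

lemma eq_zero_of_forall_rTensor {x : A ⊗[K] B}
    (h : ∀ φ : A →ₗ[K] K, TensorProduct.lid K B (φ.rTensor B x) = 0) : x = 0 := by
  refine (TensorProduct.comm K A B).map_eq_zero_iff.1 (eq_zero_of_forall_lTensor fun φ => ?_)
  have hi : ∀ y : A ⊗[K] B, TensorProduct.rid K B (φ.lTensor B (TensorProduct.comm K A B y)) =
      TensorProduct.lid K B (φ.rTensor B y) := fun y => by
    induction y with
    | zero => simp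
    | add y y' h h' => simp only [map_add, h, h']
    | tmul s t => simp
  rw [hi, h]

/-- An element of `A ⊗ A` whose contractions with linear forms on either side belong to `W`
belongs to `W ⊗ W`. -/
lemma mem_range_mapIncl {W : Submodule K A} {x : A ⊗[K] A}
    (hl : ∀ φ : A →ₗ[K] K, TensorProduct.rid K A (φ.lTensor A x) ∈ W)
    (hr : ∀ φ : A →ₗ[K] K, TensorProduct.lid K A (φ.rTensor A x) ∈ W) :
    x ∈ LinearMap.range (TensorProduct.mapIncl W W) := by
  obtain ⟨p, hp⟩ := W.subtype.exists_leftInverse_of_injective W.ker_subtype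
  have hp' : ∀ w ∈ W, W.subtype (p w) = w := fun w hw =>
    congrArg W.subtype (LinearMap.congr_fun hp ⟨w, hw⟩)
  let e : A →ₗ[K] A := W.subtype ∘ₗ p
  have h1 : e.rTensor A x = x := by
    refine sub_eq_zero.1 (eq_zero_of_forall_lTensor fun φ => ?_)
    have hi : ∀ y : A ⊗[K] A, TensorProduct.rid K A (φ.lTensor A (e.rTensor A y - y)) =
        e (TensorProduct.rid K A (φ.lTensor A y)) - TensorProduct.rid K A (φ.lTensor A y) :=
      fun y => by
        induction y with
        | zero => simp
        | add y y' h h' =>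
          simp only [map_add, map_sub] at h h' ⊢
          rw [add_sub_add_comm, h, h']
          abel
        | tmul s t => simp
    rw [hi, sub_eq_zero]
    exact hp' _ (hl φ)
  have h2 : e.lTensor A x = x := by
    refine sub_eq_zero.1 (eq_zero_of_forall_rTensor fun φ => ?_)
    have hi : ∀ y : A ⊗[K] A, TensorProduct.lid K A (φ.rTensor A (e.lTensor A y - y)) =
        e (TensorProduct.lid K A (φ.rTensor A y)) - TensorProduct.lid K A (φ.rTensor A y) :=
      fun y => by
        induction y with
        | zero => simp
        | add y y' h h' =>
          simp only [map_add, map_sub] at h h' ⊢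
          rw [add_sub_add_comm, h, h']
          abel
        | tmul s t => simp
    rw [hi, sub_eq_zero]
    exact hp' _ (hr φ)
  refine ⟨TensorProduct.map p p x, ?_⟩
  rw [TensorProduct.mapIncl, ← LinearMap.comp_apply, ← TensorProduct.map_comp]
  change TensorProduct.map e e x = x
  conv_rhs => rw [← h1, ← h2]
  rw [← LinearMap.comp_apply, LinearMap.rTensor_comp_lTensor]

end Tensor

/-! ### Subspaces containing the totally primitive elements -/

section Generation

variable {K A : Type*} [Field K] [AddCommGroup A] [Module K A] {S : BidendriformData K A}

/-- Subspaces which are stable under the two products and the two coproducts. -/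
structure IsSubbialgebra (S : BidendriformData K A) (W : Submodule K A) : Prop where
  prec_mem : ∀ a ∈ W, ∀ b ∈ W, S.prec a b ∈ W
  succ_mem : ∀ a ∈ W, ∀ b ∈ W, S.succ a b ∈ W
  coprec_mem : ∀ a ∈ W, S.coprec a ∈ LinearMap.range (TensorProduct.mapIncl W W)
  cosucc_mem : ∀ a ∈ W, S.cosucc a ∈ LinearMap.range (TensorProduct.mapIncl W W)

/-- The projection onto `Ker Δ_≻` preserves `Ker Δ_≺`. -/
lemma IsBialgebra.coprec_rightProj (hS : S.IsBialgebra) (n : ℕ) : ∀ u : A, S.coprec u = 0 →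
    S.coprec (S.rightProj n u) = 0 := by
  induction n with
  | zero => intro u _; simp [rightProj]
  | succ n ih =>
    intro u hu
    have h : S.coprec.lTensor A (S.cosucc u) = 0 := by
      rw [← hS.coalgebra.cosucc_coprec, hu]; simp
    obtain ⟨z, hz⟩ := mem_range_lTensor_ker h
    rw [rightProj_succ_apply, map_sub, hu, zero_sub, neg_eq_zero, ← hz]
    clear hz
    induction z with
    | zero => simp
    | add y y' h h' => simp only [map_add, h, h', add_zero]
    | tmul y x =>
      simp only [LinearMap.lTensor_tmul, TensorProduct.lift.tmul, Submodule.subtype_apply]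
      exact hS.coprec_succ_of_coprec_eq_zero y (ih x x.2)

lemma lift_mul_flip_mem {W : Submodule K A} (hW : S.IsSubbialgebra W) {f : A →ₗ[K] A}
    (hf : ∀ w ∈ W, f w ∈ W) {x : A ⊗[K] A}
    (hx : x ∈ LinearMap.range (TensorProduct.mapIncl W W)) :
    TensorProduct.lift S.mul.flip (f.rTensor A x) ∈ W := by
  obtain ⟨z, rfl⟩ := hx
  induction z with
  | zero => simp
  | add y y' h h' => simp only [map_add]; exact W.add_mem h h'
  | tmul y x =>
    simp only [TensorProduct.mapIncl, TensorProduct.map_tmul, LinearMap.rTensor_tmul,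
      TensorProduct.lift.tmul, Submodule.subtype_apply, LinearMap.flip_apply, mul_apply]
    exact W.add_mem (hW.prec_mem _ x.2 _ (hf _ y.2)) (hW.succ_mem _ x.2 _ (hf _ y.2))

lemma lift_succ_mem {W : Submodule K A} (hW : S.IsSubbialgebra W) {f : A →ₗ[K] A}
    (hf : ∀ w ∈ W, f w ∈ W) {x : A ⊗[K] A}
    (hx : x ∈ LinearMap.range (TensorProduct.mapIncl W W)) :
    TensorProduct.lift S.succ (f.lTensor A x) ∈ W := by
  obtain ⟨z, rfl⟩ := hx
  induction z with
  | zero => simp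
  | add y y' h h' => simp only [map_add]; exact W.add_mem h h'
  | tmul y x =>
    simp only [TensorProduct.mapIncl, TensorProduct.map_tmul, LinearMap.lTensor_tmul,
      TensorProduct.lift.tmul, Submodule.subtype_apply]
    exact hW.succ_mem _ y.2 _ (hf _ x.2)

lemma leftProj_mem {W : Submodule K A} (hW : S.IsSubbialgebra W) (n : ℕ) :
    ∀ w ∈ W, S.leftProj n w ∈ W := by
  induction n with
  | zero => intro w _; simp [leftProj]
  | succ n ih =>
    intro w hw
    exact W.sub_mem hw (lift_mul_flip_mem hW ih (hW.coprec_mem w hw))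

lemma rightProj_mem {W : Submodule K A} (hW : S.IsSubbialgebra W) (n : ℕ) :
    ∀ w ∈ W, S.rightProj n w ∈ W := by
  induction n with
  | zero => intro w _; simp [rightProj]
  | succ n ih =>
    intro w hw
    exact W.sub_mem hw (lift_succ_mem hW ih (hW.cosucc_mem w hw))

/-- If `W` is stable under all operations and contains the totally primitive elements, then it
contains the elements whose coproducts belong to `W ⊗ W`: up to elements of `W`, such an `a` is
equal to `E a`, and then to the totally primitive element `F (E a)`. -/
lemma IsBialgebra.mem_of_coproducts_mem (hS : S.IsBialgebra) {W : Submodule K A}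
    (hW : S.IsSubbialgebra W) (hV : S.primTot ≤ W) (hl : ∀ a, ∃ n, a ∈ S.coprecFil n)
    (hr : ∀ a, ∃ n, a ∈ S.cosuccFil n) {a : A}
    (h1 : S.coprec a ∈ LinearMap.range (TensorProduct.mapIncl W W))
    (h2 : S.cosucc a ∈ LinearMap.range (TensorProduct.mapIncl W W)) : a ∈ W := by
  obtain ⟨n, hn⟩ := hl a
  have hx := lift_mul_flip_mem hW (leftProj_mem hW n) h1
  obtain ⟨hu, hst⟩ := hS.leftProj_spec n a hn
  rw [← hst] at hu
  have e1 := S.leftProj_succ_apply n a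
  set u := S.leftProj (n + 1) a
  set x := TensorProduct.lift S.mul.flip ((S.leftProj n).rTensor A (S.coprec a))
  have h3 : S.cosucc u ∈ LinearMap.range (TensorProduct.mapIncl W W) := by
    rw [e1, map_sub]
    exact Submodule.sub_mem _ h2 (hW.cosucc_mem x hx)
  obtain ⟨m, hm⟩ := hr u
  have hy := lift_succ_mem hW (rightProj_mem hW m) h3
  obtain ⟨hv, hst'⟩ := hS.rightProj_spec m u hm
  rw [← hst'] at hv
  have e2 := S.rightProj_succ_apply m u
  have hv' : S.rightProj (m + 1) u ∈ W :=
    hV ⟨hS.coprec_rightProj (m + 1) u hu, hv⟩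
  rw [e2] at hv'
  have hu' : u ∈ W := by simpa using W.add_mem hv' hy
  rw [e1] at hu'
  simpa using W.add_mem hu' hx

end Generation

/-! ### Iterated coproducts and connectedness -/

section Connected

variable {K C : Type*} [Field K] [AddCommGroup C] [Module K C] {S : BidendriformData K C}

lemma IsIteratedCoproduct.applyAt_comp {δ : C →ₗ[K] C ⊗[K] C}
    (hδ : δ = S.coprec ∨ δ = S.cosucc) {n : ℕ} {P : C →ₗ[K] tensorPow K C n}
    (hP : S.IsIteratedCoproduct n P) (i : Fin (n + 1)) :
    S.IsIteratedCoproduct (n + 1) (applyAt δ n i ∘ₗ P) := by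
  rcases hδ with rfl | rfl
  · exact .coprec n P i hP
  · exact .cosucc n P i hP

/-- `(Id ⊗ P) Δ` is an iterated coproduct if `P` is one. -/
lemma IsIteratedCoproduct.lTensor {δ : C →ₗ[K] C ⊗[K] C}
    (hδ : δ = S.coprec ∨ δ = S.cosucc) {n : ℕ} {P : C →ₗ[K] tensorPow K C n}
    (hP : S.IsIteratedCoproduct n P) :
    S.IsIteratedCoproduct (n + 1) (P.lTensor C ∘ₗ δ : C →ₗ[K] C ⊗[K] tensorPow K C n) := by
  have step : ∀ (δ' : C →ₗ[K] C ⊗[K] C) (n : ℕ) (P : C →ₗ[K] tensorPow K C n) (i : Fin (n + 1)),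
      applyAt δ' (n + 1) i.succ ∘ₗ (P.lTensor C ∘ₗ δ : C →ₗ[K] C ⊗[K] tensorPow K C n) =
        ((applyAt δ' n i ∘ₗ P).lTensor C ∘ₗ δ : C →ₗ[K] C ⊗[K] tensorPow K C (n + 1)) :=
    fun δ' n P i => LinearMap.ext fun x => (LinearMap.lTensor_comp_apply C _ _ (δ x)).symm
  induction hP with
  | id =>
    have e : (applyAt δ 0 0 ∘ₗ (LinearMap.id : C →ₗ[K] C) : C →ₗ[K] C ⊗[K] C) =
        (LinearMap.id : C →ₗ[K] C).lTensor C ∘ₗ δ := by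
      rw [LinearMap.lTensor_id]; rfl
    exact e ▸ IsIteratedCoproduct.applyAt_comp hδ (.id (S := S)) 0
  | coprec n P i _ ih => exact step _ n P i ▸ ih.applyAt_comp (.inl rfl) i.succ
  | cosucc n P i _ ih => exact step _ n P i ▸ ih.applyAt_comp (.inr rfl) i.succ

/-- The isomorphism `C^{⊗ (n+1)} ⊗ C = C^{⊗ (n+2)}`. -/
noncomputable def tensorPowSnoc (K C : Type*) [Field K] [AddCommGroup C] [Module K C] :
    (n : ℕ) → (tensorPow K C n ⊗[K] C ≃ₗ[K] tensorPow K C (n + 1))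
  | 0 => LinearEquiv.refl K (C ⊗[K] C)
  | n + 1 => (TensorProduct.assoc K C (tensorPow K C n) C).trans
      (LinearEquiv.lTensor C (tensorPowSnoc K C n))

section Generic

variable {T T' U U' : Type*} [AddCommGroup T] [Module K T] [AddCommGroup T'] [Module K T']
  [AddCommGroup U] [Module K U] [AddCommGroup U'] [Module K U']

/-- The case of the leftmost factor in the induction step of `tensorPowSnoc_applyAt`. -/
lemma lTensor_assoc_rTensor_assoc (δ : C →ₗ[K] C ⊗[K] C) (φ : T ⊗[K] C →ₗ[K] T')
    (z : (C ⊗[K] T) ⊗[K] C) :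
    (φ.lTensor C ∘ₗ (TensorProduct.assoc K C T C).toLinearMap).lTensor C
      (TensorProduct.assoc K C (C ⊗[K] T) C
        (((TensorProduct.assoc K C C T).toLinearMap ∘ₗ δ.rTensor T).rTensor C z)) =
    TensorProduct.assoc K C C T' (δ.rTensor T'
      (φ.lTensor C (TensorProduct.assoc K C T C z))) := by
  induction z with
  | zero => simp
  | add y y' h h' => simp only [map_add, h, h']
  | tmul y c =>
    induction y with
    | zero => simp
    | add y y' h h' => simp only [TensorProduct.add_tmul, map_add, h, h']
    | tmul x t =>
      simp only [LinearMap.rTensor_tmul, LinearMap.comp_apply, LinearEquiv.coe_coe,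
        TensorProduct.assoc_tmul, LinearMap.lTensor_tmul]
      induction δ x with
      | zero => simp
      | add y y' h h' => simp only [TensorProduct.add_tmul, map_add, h, h']
      | tmul a b => simp

/-- The case of the other factors in the induction step of `tensorPowSnoc_applyAt`. -/
lemma lTensor_assoc_rTensor_lTensor {f : T →ₗ[K] U} {f' : T' →ₗ[K] U'} {φ : T ⊗[K] C →ₗ[K] T'}
    {ψ : U ⊗[K] C →ₗ[K] U'} (h : ∀ z, ψ (f.rTensor C z) = f' (φ z)) (z : (C ⊗[K] T) ⊗[K] C) :
    ψ.lTensor C (TensorProduct.assoc K C U C ((f.lTensor C).rTensor C z)) =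
    f'.lTensor C (φ.lTensor C (TensorProduct.assoc K C T C z)) := by
  induction z with
  | zero => simp
  | add y y' h h' => simp only [map_add, h, h']
  | tmul y c =>
    induction y with
    | zero => simp
    | add y y' h h' => simp only [TensorProduct.add_tmul, map_add, h, h']
    | tmul x t => simpa using congrArg (x ⊗ₜ[K] ·) (h (t ⊗ₜ c))

end Generic

/-- Adding a factor on the right does not affect the position at which a coproduct is applied. -/
lemma tensorPowSnoc_applyAt (δ : C →ₗ[K] C ⊗[K] C) (n : ℕ) (i : Fin (n + 1)) :
    ∀ z : tensorPow K C n ⊗[K] C, tensorPowSnoc K C (n + 1) ((applyAt δ n i).rTensor C z) =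
      applyAt δ (n + 1) i.castSucc (tensorPowSnoc K C n z) := by
  induction n with
  | zero =>
    intro z
    obtain rfl : i = 0 := Fin.fin_one_eq_zero i
    change (LinearMap.id (R := K) (M := C ⊗[K] C)).lTensor C
      (TensorProduct.assoc K C C C (δ.rTensor C z)) = TensorProduct.assoc K C C C (δ.rTensor C z)
    rw [LinearMap.lTensor_id_apply]
  | succ n ih =>
    refine Fin.cases ?_ (fun j => ?_) i
    · exact lTensor_assoc_rTensor_assoc δ (tensorPowSnoc K C n).toLinearMap
    · exact lTensor_assoc_rTensor_lTensor (φ := (tensorPowSnoc K C n).toLinearMap)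
        (ψ := (tensorPowSnoc K C (n + 1)).toLinearMap) (ih j)

/-- `(P ⊗ Id) Δ` is an iterated coproduct if `P` is one. -/
lemma IsIteratedCoproduct.rTensor {δ : C →ₗ[K] C ⊗[K] C}
    (hδ : δ = S.coprec ∨ δ = S.cosucc) {n : ℕ} {P : C →ₗ[K] tensorPow K C n}
    (hP : S.IsIteratedCoproduct n P) :
    S.IsIteratedCoproduct (n + 1) ((tensorPowSnoc K C n).toLinearMap ∘ₗ P.rTensor C ∘ₗ δ) := by
  have step : ∀ (δ' : C →ₗ[K] C ⊗[K] C) (n : ℕ) (P : C →ₗ[K] tensorPow K C n) (i : Fin (n + 1)),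
      applyAt δ' (n + 1) i.castSucc ∘ₗ ((tensorPowSnoc K C n).toLinearMap ∘ₗ P.rTensor C ∘ₗ δ) =
        (tensorPowSnoc K C (n + 1)).toLinearMap ∘ₗ (applyAt δ' n i ∘ₗ P).rTensor C ∘ₗ δ :=
    fun δ' n P i => LinearMap.ext fun x =>
      (tensorPowSnoc_applyAt δ' n i (P.rTensor C (δ x))).symm.trans
        (congrArg _ (LinearMap.rTensor_comp_apply C _ _ (δ x)).symm)
  induction hP with
  | id =>
    have e : (applyAt δ 0 0 ∘ₗ (LinearMap.id : C →ₗ[K] C) : C →ₗ[K] C ⊗[K] C) =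
        (LinearMap.id : C →ₗ[K] C).rTensor C ∘ₗ δ := by
      rw [LinearMap.rTensor_id]; rfl
    exact e ▸ IsIteratedCoproduct.applyAt_comp hδ (.id (S := S)) 0
  | coprec n P i _ ih => exact step _ n P i ▸ ih.applyAt_comp (.inl rfl) i.castSucc
  | cosucc n P i _ ih => exact step _ n P i ▸ ih.applyAt_comp (.inr rfl) i.castSucc

/-- Connectedness is applied to the iterations `P` of `Δ_≺` on the leftmost factor; the kernel of
`P ⊗ Id` is `Ker P ⊗ A`, as modules over a field are flat. -/
lemma IsConnected.exists_mem_coprecFil (h : S.IsConnected) (a : C) : ∃ n, a ∈ S.coprecFil n := by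
  have key : ∀ n, ∃ P : C →ₗ[K] tensorPow K C n, S.IsIteratedCoproduct n P ∧
      LinearMap.ker P ≤ S.coprecFil n := by
    intro n
    induction n with
    | zero => exact ⟨LinearMap.id, .id, fun x hx => hx⟩
    | succ n ih =>
      obtain ⟨P, hP, hle⟩ := ih
      refine ⟨_, hP.rTensor (.inl rfl), fun x hx => ?_⟩
      have hx' : P.rTensor C (S.coprec x) = 0 :=
        (tensorPowSnoc K C n).map_eq_zero_iff.1 hx
      obtain ⟨z, hz⟩ := mem_range_rTensor_ker hx'
      refine ⟨(Submodule.inclusion hle).rTensor C z, ?_⟩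
      rw [← hz, ← LinearMap.rTensor_comp_apply]
      rfl
  obtain ⟨n, hn⟩ := h a
  obtain ⟨P, hP, hle⟩ := key n
  exact ⟨n, hle (hn P hP)⟩

/-- Connectedness is applied to the iterations of `Δ_≻` on the rightmost factor. -/
lemma IsConnected.exists_mem_cosuccFil (h : S.IsConnected) (a : C) : ∃ n, a ∈ S.cosuccFil n := by
  have key : ∀ n, ∃ P : C →ₗ[K] tensorPow K C n, S.IsIteratedCoproduct n P ∧
      LinearMap.ker P ≤ S.cosuccFil n := by
    intro n
    induction n with
    | zero => exact ⟨LinearMap.id, .id, fun x hx => hx⟩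
    | succ n ih =>
      obtain ⟨P, hP, hle⟩ := ih
      refine ⟨_, hP.lTensor (.inr rfl), fun x hx => ?_⟩
      have hx' : P.lTensor C (S.cosucc x) = 0 := hx
      obtain ⟨z, hz⟩ := mem_range_lTensor_ker hx'
      refine ⟨(Submodule.inclusion hle).lTensor C z, ?_⟩
      rw [← hz, ← LinearMap.lTensor_comp_apply]
      rfl
  obtain ⟨n, hn⟩ := h a
  obtain ⟨P, hP, hle⟩ := key n
  exact ⟨n, hle (hn P hP)⟩

/-- An induction principle for connected coalgebras: if `W` contains every element whose two
coproducts belong to `W ⊗ W`, then `W` is everything. Indeed an element outside of `W` has a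
coproduct with a contraction which is again outside of `W`, and so on: this gives nonzero iterated
coproducts of every order. -/
lemma IsConnected.eq_top (h : S.IsConnected) {W : Submodule K C}
    (hW : ∀ a, S.coprec a ∈ LinearMap.range (TensorProduct.mapIncl W W) →
      S.cosucc a ∈ LinearMap.range (TensorProduct.mapIncl W W) → a ∈ W) : W = ⊤ := by
  have step : ∀ a ∉ W, ∃ δ : C →ₗ[K] C ⊗[K] C, (δ = S.coprec ∨ δ = S.cosucc) ∧
      ∃ φ : C →ₗ[K] K, TensorProduct.rid K C (φ.lTensor C (δ a)) ∉ W ∨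
        TensorProduct.lid K C (φ.rTensor C (δ a)) ∉ W := by
    intro a ha
    by_contra! hcon
    exact ha (hW a
      (mem_range_mapIncl (fun φ => (hcon _ (.inl rfl) φ).1) fun φ => (hcon _ (.inl rfl) φ).2)
      (mem_range_mapIncl (fun φ => (hcon _ (.inr rfl) φ).1) fun φ => (hcon _ (.inr rfl) φ).2))
  have key : ∀ (n : ℕ) (a : C), a ∉ W → ∃ P : C →ₗ[K] tensorPow K C n,
      S.IsIteratedCoproduct n P ∧ P a ≠ 0 := by
    intro n
    induction n with
    | zero =>
      intro a ha
      refine ⟨LinearMap.id, .id, fun h0 => ha ?_⟩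
      have h0' : a = 0 := h0
      exact h0' ▸ W.zero_mem
    | succ n ih =>
      intro a ha
      obtain ⟨δ, hδ, φ, hφ | hφ⟩ := step a ha
      · obtain ⟨P, hP, hne⟩ := ih _ hφ
        refine ⟨_, hP.rTensor hδ, fun h0 => hne ?_⟩
        have h0' : P.rTensor C (δ a) = 0 := (tensorPowSnoc K C n).map_eq_zero_iff.1 h0
        have e : ∀ y : C ⊗[K] C, P (TensorProduct.rid K C (φ.lTensor C y)) =
            TensorProduct.rid K _ (φ.lTensor _ (P.rTensor C y)) := fun y => by
          induction y with
          | zero => simp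
          | add y y' h h' => simp only [map_add, h, h']
          | tmul s t => simp
        rw [e, h0', map_zero, map_zero]
      · obtain ⟨P, hP, hne⟩ := ih _ hφ
        refine ⟨_, hP.lTensor hδ, fun h0 => hne ?_⟩
        have h0' : P.lTensor C (δ a) = 0 := h0
        have e : ∀ y : C ⊗[K] C, P (TensorProduct.lid K C (φ.rTensor C y)) =
            TensorProduct.lid K _ (φ.rTensor _ (P.lTensor C y)) := fun y => by
          induction y with
          | zero => simp
          | add y y' h h' => simp only [map_add, h, h']
          | tmul s t => simp
        rw [e, h0', map_zero, map_zero]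
  refine eq_top_iff.2 fun a _ => ?_
  by_contra ha
  obtain ⟨n, hn⟩ := h a
  obtain ⟨P, hP, hne⟩ := key n a ha
  exact hne (hn P hP)

/-- A connected bidendriform bialgebra is generated by its totally primitive elements. -/
theorem IsBialgebra.eq_top_of_primTot_le (hS : S.IsBialgebra) (h : S.IsConnected)
    {W : Submodule K C} (hW : S.IsSubbialgebra W) (hV : S.primTot ≤ W) : W = ⊤ :=
  h.eq_top fun _ => hS.mem_of_coproducts_mem hW hV h.exists_mem_coprecFil h.exists_mem_cosuccFil

end Connected

end BidendriformData

namespace BidendriformData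

/-! ### Compatibility of a linear map with the coproducts -/

section Hom

variable {K A B : Type*} [Field K] [AddCommGroup A] [Module K A] [AddCommGroup B] [Module K B]
  {S : BidendriformData K A} {T : BidendriformData K B} {Ψ : A →ₗ[K] B}

lemma IsDendriformAlgebra.mul_assoc (h : S.IsDendriformAlgebra) (a b c : A) :
    S.mul (S.mul a b) c = S.mul a (S.mul b c) := by
  have h1 := h.prec_prec a b c
  have h2 := h.succ_prec a b c
  have h3 := h.succ_succ a b c
  simp only [mul, LinearMap.add_apply, map_add] at h1 h2 h3 ⊢
  rw [h1, h2, ← h3]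
  abel

lemma map_lTensor_comm {f : A →ₗ[K] A} {g : B →ₗ[K] B} (h : ∀ x, Ψ (f x) = g (Ψ x))
    (x : A ⊗[K] A) :
    TensorProduct.map Ψ Ψ (f.lTensor A x) = g.lTensor B (TensorProduct.map Ψ Ψ x) := by
  induction x with
  | zero => simp
  | add y y' h h' => simp only [map_add, h, h']
  | tmul s t => simp [h]

lemma map_rTensor_comm {f : A →ₗ[K] A} {g : B →ₗ[K] B} (h : ∀ x, Ψ (f x) = g (Ψ x))
    (x : A ⊗[K] A) :
    TensorProduct.map Ψ Ψ (f.rTensor A x) = g.rTensor B (TensorProduct.map Ψ Ψ x) := by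
  induction x with
  | zero => simp
  | add y y' h h' => simp only [map_add, h, h']
  | tmul s t => simp [h]

lemma map_map₂_comm {φ φ' : A →ₗ[K] A →ₗ[K] A} {χ χ' : B →ₗ[K] B →ₗ[K] B}
    (h : ∀ x y, Ψ (φ x y) = χ (Ψ x) (Ψ y)) (h' : ∀ x y, Ψ (φ' x y) = χ' (Ψ x) (Ψ y))
    (x y : A ⊗[K] A) :
    TensorProduct.map Ψ Ψ (TensorProduct.map₂ φ φ' x y) =
      TensorProduct.map₂ χ χ' (TensorProduct.map Ψ Ψ x) (TensorProduct.map Ψ Ψ y) := by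
  induction x with
  | zero => simp
  | add x x' h h' => simp only [map_add, LinearMap.add_apply, h, h']
  | tmul s t =>
    induction y with
    | zero => simp
    | add y y' h h' => simp only [map_add, h, h']
    | tmul s' t' =>
      simp only [TensorProduct.map₂_apply_tmul, TensorProduct.map_tmul, h, h']

/-- The elements on which a linear map is compatible with the two coproducts. -/
noncomputable def coproductLocus (S : BidendriformData K A) (T : BidendriformData K B)
    (Ψ : A →ₗ[K] B) : Submodule K A :=
  LinearMap.eqLocus (T.coprec ∘ₗ Ψ) (TensorProduct.map Ψ Ψ ∘ₗ S.coprec) ⊓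
    LinearMap.eqLocus (T.cosucc ∘ₗ Ψ) (TensorProduct.map Ψ Ψ ∘ₗ S.cosucc)

lemma mem_coproductLocus {a : A} : a ∈ coproductLocus S T Ψ ↔
    T.coprec (Ψ a) = TensorProduct.map Ψ Ψ (S.coprec a) ∧
      T.cosucc (Ψ a) = TensorProduct.map Ψ Ψ (S.cosucc a) := Iff.rfl

/-- If a linear map between bidendriform bialgebras is compatible with the products, then the
elements on which it is compatible with the coproducts are stable under the products. -/
lemma IsBialgebra.coproductLocus_closed (hS : S.IsBialgebra) (hT : T.IsBialgebra)
    (hp : ∀ a b, Ψ (S.prec a b) = T.prec (Ψ a) (Ψ b))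
    (hs : ∀ a b, Ψ (S.succ a b) = T.succ (Ψ a) (Ψ b)) {a b : A}
    (ha : a ∈ coproductLocus S T Ψ) (hb : b ∈ coproductLocus S T Ψ) :
    S.prec a b ∈ coproductLocus S T Ψ ∧ S.succ a b ∈ coproductLocus S T Ψ := by
  have hm : ∀ a b, Ψ (S.mul a b) = T.mul (Ψ a) (Ψ b) := fun a b => by
    simp only [mul, LinearMap.add_apply, map_add, hp, hs]
  have hc : T.comul (Ψ a) = TensorProduct.map Ψ Ψ (S.comul a) := by
    simp only [comul, LinearMap.add_apply, map_add]
    exact congrArg₂ _ ha.1 ha.2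
  obtain ⟨hb1, hb2⟩ := mem_coproductLocus.1 hb
  simp only [mem_coproductLocus]
  refine ⟨⟨?_, ?_⟩, ?_, ?_⟩
  · rw [hp, hT.coprec_prec, hS.coprec_prec, hc, hb1]
    simp only [map_add, map_map₂_comm hm hp, TensorProduct.map_tmul,
      map_rTensor_comm (f := S.mul.flip b) (g := T.mul.flip (Ψ b)) fun x => hm x b,
      map_lTensor_comm (hp a)]
  · rw [hp, hT.cosucc_prec, hS.cosucc_prec, hc, hb2]
    simp only [map_add, map_map₂_comm hm hp,
      map_lTensor_comm (f := S.prec.flip b) (g := T.prec.flip (Ψ b)) fun x => hp x b,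
      map_lTensor_comm (hp a)]
  · rw [hs, hT.coprec_succ, hS.coprec_succ, hc, hb1]
    simp only [map_add, map_map₂_comm hm hs, map_rTensor_comm (hm a), map_lTensor_comm (hs a)]
  · rw [hs, hT.cosucc_succ, hS.cosucc_succ, hc, hb2]
    simp only [map_add, map_map₂_comm hm hs, TensorProduct.map_tmul, map_rTensor_comm (hm a),
      map_lTensor_comm (f := S.succ.flip b) (g := T.succ.flip (Ψ b)) fun x => hs x b,
      map_lTensor_comm (hs a)]

end Hom

end BidendriformData

namespace ForestSpace

open PlanarForest BidendriformData

/-! ### The universal property of the forests -/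

section Universal

variable {K D A : Type*} [Field K] [AddCommGroup A] [Module K A] {S : BidendriformData K A}

lemma vertex_mem_primTot (d : D) : vertex K d ∈ (data K D).primTot := by
  constructor
  · change (data K D).coprec _ = 0
    rw [vertex, coprec_ofForest, graft, sumCutsOf_true_graft]
    simp
  · change (data K D).cosucc _ = 0
    rw [vertex, cosucc_ofForest, graft, sumCutsOf_false_graft]
    simp

lemma ofForest_graft_eq_prec (d : D) {C : PlanarForest D} (hC : C ≠ nil) :
    ofForest K (cons d C nil) = (data K D).prec (vertex K d) (ofForest K C) := by
  rw [vertex, graft, prec_ofForest K (cons_ne_nil _ _ _) hC, graft_precForest, nil_append]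

lemma ofForest_cons_eq_mul (d : D) (C : PlanarForest D) {R : PlanarForest D} (hR : R ≠ nil) :
    ofForest K (cons d C R) = (data K D).mul (ofForest K (cons d C nil)) (ofForest K R) := by
  rw [mul_ofForest K (cons_ne_nil _ _ _) hR, cons_append, nil_append]

/-- The dendriform algebra of forests is generated by the vertices. -/
lemma eq_top_of_closed {W : Submodule K (ForestSpace K D)} (hv : ∀ d, vertex K d ∈ W)
    (hp : ∀ a ∈ W, ∀ b ∈ W, (data K D).prec a b ∈ W)
    (hs : ∀ a ∈ W, ∀ b ∈ W, (data K D).succ a b ∈ W) : W = ⊤ := by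
  have hF : ∀ F : PlanarForest D, ofForest K F ∈ W := by
    intro F
    induction F with
    | nil => exact W.zero_mem
    | cons d C R ihC ihR =>
      have ht : ofForest K (cons d C nil) ∈ W := by
        by_cases hC : C = nil
        · subst hC; exact hv d
        · rw [ofForest_graft_eq_prec d hC]; exact hp _ (hv d) _ ihC
      by_cases hR : R = nil
      · subst hR; exact ht
      · rw [ofForest_cons_eq_mul d C hR, BidendriformData.mul_apply]
        exact W.add_mem (hp _ ht _ ihR) (hs _ ht _ ihR)
  refine eq_top_iff.2 fun x _ => ?_
  induction x using forest_induction with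
  | zero => exact W.zero_mem
  | add x y hx hy => exact W.add_mem (hx trivial) (hy trivial)
  | smul r x hx => exact W.smul_mem r (hx trivial)
  | forest F _ => exact hF F

/-- A morphism of dendriform algebras defined on forests is determined by the images of the
vertices. -/
lemma hom_eq {Ψ Ψ' : ForestSpace K D →ₗ[K] A}
    (hΨ : (data K D).IsHom S Ψ) (hΨ' : (data K D).IsHom S Ψ')
    (h : ∀ d, Ψ (vertex K d) = Ψ' (vertex K d)) : Ψ = Ψ' := by
  have : LinearMap.eqLocus Ψ Ψ' = ⊤ := by
    refine eq_top_of_closed h (fun a ha b hb => ?_) fun a ha b hb => ?_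
    · have ha' : Ψ a = Ψ' a := ha
      have hb' : Ψ b = Ψ' b := hb
      change Ψ _ = Ψ' _
      rw [hΨ.map_prec, hΨ'.map_prec, ha', hb']
    · have ha' : Ψ a = Ψ' a := ha
      have hb' : Ψ b = Ψ' b := hb
      change Ψ _ = Ψ' _
      rw [hΨ.map_succ, hΨ'.map_succ, ha', hb']
  exact LinearMap.eqLocus_eq_top.1 this

/-- The image of a forest under the morphism of dendriform algebras sending each vertex `d` to
`p d`; it is determined by `B_d^+(C) = d ≺ C` and by multiplicativity. The empty forest is sent to
`0`, and the terms with `epsilon` take care of the empty forests of subtrees. -/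
noncomputable def evalForest (S : BidendriformData K A) (p : D → A) : PlanarForest D → A
  | nil => 0
  | cons d C R =>
    epsilon R (epsilon C (p d) + S.prec (p d) (evalForest S p C)) +
      S.mul (epsilon C (p d) + S.prec (p d) (evalForest S p C)) (evalForest S p R)

variable (p : D → A)

lemma evalForest_vertex (d : D) : evalForest S p (cons d nil nil) = p d := by
  simp [evalForest]

lemma evalForest_graft (d : D) {C : PlanarForest D} (hC : C ≠ nil) :
    evalForest S p (cons d C nil) = S.prec (p d) (evalForest S p C) := by
  simp [evalForest, epsilon_of_ne_nil hC]

lemma evalForest_cons (d : D) (C : PlanarForest D) {R : PlanarForest D} (hR : R ≠ nil) :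
    evalForest S p (cons d C R) =
      S.mul (evalForest S p (cons d C nil)) (evalForest S p R) := by
  simp [evalForest, epsilon_of_ne_nil hR]

variable {p}

lemma evalForest_append (h : S.IsDendriformAlgebra) {F G : PlanarForest D} (hF : F ≠ nil)
    (hG : G ≠ nil) :
    evalForest S p (F.append G) = S.mul (evalForest S p F) (evalForest S p G) := by
  induction F with
  | nil => exact absurd rfl hF
  | cons d C R _ ih =>
    by_cases hR : R = nil
    · subst hR; exact evalForest_cons p d C hG
    · rw [cons_append, evalForest_cons p d C (append_ne_nil_right R hG), ih hR,
        evalForest_cons p d C hR, IsDendriformAlgebra.mul_assoc h]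

lemma evalForest_graft_append (h : S.IsDendriformAlgebra) (d : D) (C : PlanarForest D)
    {G : PlanarForest D} (hG : G ≠ nil) : evalForest S p (cons d (C.append G) nil) =
      S.prec (evalForest S p (cons d C nil)) (evalForest S p G) := by
  by_cases hC : C = nil
  · subst hC
    rw [nil_append, evalForest_graft p d hG, evalForest_vertex]
  · rw [evalForest_graft p d hC, h.prec_prec, evalForest_graft p d (append_ne_nil_right C hG),
      evalForest_append h hC hG]
    rfl

lemma extend_evalForest (F : PlanarForest D) :
    extend K (evalForest S p) (ofForest K F) = evalForest S p F := by
  cases F with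
  | nil => simp [evalForest]
  | cons d C R => simp

lemma extend_evalForest_vertex (p : D → A) (d : D) :
    extend K (evalForest S p) (vertex K d) = p d := by
  rw [vertex, extend_evalForest, graft, evalForest_vertex]

lemma extend_evalForest_precForest (h : S.IsDendriformAlgebra) (F : PlanarForest D)
    {G : PlanarForest D} (hG : G ≠ nil) : extend K (evalForest S p) (precForest K F G) =
      S.prec (evalForest S p F) (evalForest S p G) := by
  induction F with
  | nil => simp [evalForest]
  | cons d C R _ ih =>
    set t := evalForest S p (cons d C nil) with ht
    have e1 : ∀ x, extend K (fun F => evalForest S p (cons d C F)) x =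
        S.mul t (extend K (evalForest S p) x) := fun x => by
      rw [map_extend]
      congr 1
      exact extend_congr K fun F hF => evalForest_cons p d C hF
    have e2 : ∀ x, extend K (fun F => evalForest S p (cons d (C.append F) nil)) x =
        S.prec t (extend K (evalForest S p) x) := fun x => by
      rw [map_extend]
      congr 1
      exact extend_congr K fun F hF => evalForest_graft_append h d C hF
    rw [extend_precForest_cons, e1, e2, ih,
      evalForest_graft_append h d C (append_ne_nil_right R hG), ← ht]
    by_cases hR : R = nil
    · subst hR
      simp [evalForest, ht]
    · rw [evalForest_append h hR hG, evalForest_cons p d C hR, ← ht]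
      have h1 := h.prec_prec t (evalForest S p R) (evalForest S p G)
      have h2 := h.succ_prec t (evalForest S p R) (evalForest S p G)
      simp only [mul, LinearMap.add_apply, map_add] at h1 h2 ⊢
      rw [h1, h2]
      abel

lemma extend_evalForest_prec (h : S.IsDendriformAlgebra) (a b : ForestSpace K D) :
    extend K (evalForest S p) ((data K D).prec a b) =
      S.prec (extend K (evalForest S p) a) (extend K (evalForest S p) b) := by
  induction a using forest_induction with
  | zero => simp
  | add x y hx hy => simp only [map_add, LinearMap.add_apply, hx, hy]
  | smul r x hx => simp only [map_smul, LinearMap.smul_apply, hx]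
  | forest F hF =>
  induction b using forest_induction with
  | zero => simp
  | add x y hx hy => simp only [map_add, hx, hy]
  | smul r x hx => simp only [map_smul, hx]
  | forest G hG =>
  rw [prec_ofForest K hF hG, extend_evalForest_precForest h F hG, extend_evalForest,
    extend_evalForest]

lemma extend_evalForest_succ (h : S.IsDendriformAlgebra) (a b : ForestSpace K D) :
    extend K (evalForest S p) ((data K D).succ a b) =
      S.succ (extend K (evalForest S p) a) (extend K (evalForest S p) b) := by
  induction a using forest_induction with
  | zero => simp
  | add x y hx hy => simp only [map_add, LinearMap.add_apply, hx, hy]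
  | smul r x hx => simp only [map_smul, LinearMap.smul_apply, hx]
  | forest F hF =>
  induction b using forest_induction with
  | zero => simp
  | add x y hx hy => simp only [map_add, hx, hy]
  | smul r x hx => simp only [map_smul, hx]
  | forest G hG =>
  rw [succ_ofForest K hF hG, succForest, map_sub, extend_evalForest_precForest h F hG,
    extend_evalForest, extend_evalForest, extend_evalForest, evalForest_append h hF hG,
    BidendriformData.mul_apply, add_sub_cancel_left]

/-- The morphism of bidendriform bialgebras sending the vertices to given totally primitive
elements. All coproducts in question vanish on the vertices, and the compatibility with the
coproducts propagates to the dendriform algebra generated by them. -/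
theorem isHom_extend_evalForest (hS : S.IsBialgebra) (hp : ∀ d, p d ∈ S.primTot) :
    (data K D).IsHom S (extend K (evalForest S p)) := by
  have h : coproductLocus (data K D) S (extend K (evalForest S p)) = ⊤ := by
    have hcl := fun a ha b hb => (isBialgebra K (D := D)).coproductLocus_closed hS (a := a)
      (b := b) (extend_evalForest_prec (p := p) hS.algebra)
      (extend_evalForest_succ hS.algebra) ha hb
    refine eq_top_of_closed (fun d => ?_) (fun a ha b hb => (hcl a ha b hb).1)
      fun a ha b hb => (hcl a ha b hb).2
    have h1 : (data K D).coprec (vertex K d) = 0 := (vertex_mem_primTot d).1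
    have h2 : (data K D).cosucc (vertex K d) = 0 := (vertex_mem_primTot d).2
    have h3 : S.coprec (p d) = 0 := (hp d).1
    have h4 : S.cosucc (p d) = 0 := (hp d).2
    rw [mem_coproductLocus, extend_evalForest_vertex, h1, h2, h3, h4]
    simp
  have h' : ∀ a, a ∈ coproductLocus (data K D) S (extend K (evalForest S p)) := fun a =>
    h ▸ trivial
  exact ⟨extend_evalForest_prec hS.algebra, extend_evalForest_succ hS.algebra,
    fun a => (h' a).1, fun a => (h' a).2⟩

end Universal

end ForestSpace

namespace BidendriformData

/-! ### Elements generated by a subspace under left multiplications -/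

section LeftSpan

variable {K A : Type*} [Field K] [AddCommGroup A] [Module K A] {S : BidendriformData K A}
  {V : Submodule K A}

/-- The subspace spanned by `V` and by the elements `a ≻ v` with `v ∈ V`. -/
def succSpan (S : BidendriformData K A) (V : Submodule K A) : Submodule K A :=
  V ⊔ Submodule.map₂ S.succ ⊤ V

/-- The subspace spanned by the elements `u` and `a u` with `u ∈ S.succSpan V`. -/
def mulSuccSpan (S : BidendriformData K A) (V : Submodule K A) : Submodule K A :=
  S.succSpan V ⊔ Submodule.map₂ S.mul ⊤ (S.succSpan V)

lemma succ_mem_succSpan (h : S.IsDendriformAlgebra) (a : A) {u : A} (hu : u ∈ S.succSpan V) :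
    S.succ a u ∈ S.succSpan V := by
  have : S.succSpan V ≤ (S.succSpan V).comap (S.succ a) := by
    refine sup_le (fun v hv => ?_) (Submodule.map₂_le.2 fun b _ v hv => ?_)
    · exact Submodule.mem_sup_right (Submodule.apply_mem_map₂ _ trivial hv)
    · rw [Submodule.mem_comap, ← h.succ_succ]
      exact Submodule.mem_sup_right (Submodule.apply_mem_map₂ _ trivial hv)
  exact this hu

lemma mul_mem_mulSuccSpan (h : S.IsDendriformAlgebra) (a : A) {x : A}
    (hx : x ∈ S.mulSuccSpan V) : S.mul a x ∈ S.mulSuccSpan V := by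
  have : S.mulSuccSpan V ≤ (S.mulSuccSpan V).comap (S.mul a) := by
    refine sup_le (fun u hu => ?_) (Submodule.map₂_le.2 fun b _ u hu => ?_)
    · exact Submodule.mem_sup_right (Submodule.apply_mem_map₂ _ trivial hu)
    · rw [Submodule.mem_comap, ← h.mul_assoc]
      exact Submodule.mem_sup_right (Submodule.apply_mem_map₂ _ trivial hu)
  exact this hx

/-- Stability under `≺` follows from `a ≺ u = a u - a ≻ u` and `a ≺ (b u) = (a ≺ b) ≺ u`. -/
lemma prec_mem_mulSuccSpan (h : S.IsDendriformAlgebra) (a : A) {x : A}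
    (hx : x ∈ S.mulSuccSpan V) : S.prec a x ∈ S.mulSuccSpan V := by
  have hU : ∀ a, ∀ u ∈ S.succSpan V, S.prec a u ∈ S.mulSuccSpan V := by
    intro a u hu
    have e : S.prec a u = S.mul a u - S.succ a u := by rw [mul_apply]; abel
    rw [e]
    exact Submodule.sub_mem _
      (Submodule.mem_sup_right (Submodule.apply_mem_map₂ _ trivial hu))
      (Submodule.mem_sup_left (succ_mem_succSpan h a hu))
  have : S.mulSuccSpan V ≤ (S.mulSuccSpan V).comap (S.prec a) := by
    refine sup_le (fun u hu => hU a u hu) (Submodule.map₂_le.2 fun b _ u hu => ?_)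
    rw [Submodule.mem_comap, mul_apply, ← h.prec_prec]
    exact hU _ u hu
  exact this hx

lemma succ_mem_mulSuccSpan (h : S.IsDendriformAlgebra) (a : A) {x : A}
    (hx : x ∈ S.mulSuccSpan V) : S.succ a x ∈ S.mulSuccSpan V := by
  have e : S.succ a x = S.mul a x - S.prec a x := by rw [mul_apply]; abel
  rw [e]
  exact Submodule.sub_mem _ (mul_mem_mulSuccSpan h a hx) (prec_mem_mulSuccSpan h a hx)

lemma IsBialgebra.succSpan_le_ker_coprec (hS : S.IsBialgebra) (hV : V ≤ S.primTot) :
    S.succSpan V ≤ LinearMap.ker S.coprec :=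
  sup_le (fun _ hv => (hV hv).1) (Submodule.map₂_le.2 fun a _ _ hv =>
    hS.coprec_succ_of_coprec_eq_zero a (hV hv).1)

variable (S) in
/-- The elements which the truncations of `F ∘ E` eventually send to `V`. -/
noncomputable def eventuallyMem (V : Submodule K A) : Submodule K A where
  carrier := {x | ∃ N, ∀ n ≥ N, S.rightProj n (S.leftProj n x) ∈ V}
  zero_mem' := ⟨0, fun n _ => by simp⟩
  add_mem' := by
    rintro x y ⟨N, hN⟩ ⟨N', hN'⟩
    refine ⟨max N N', fun n hn => ?_⟩
    simp only [map_add]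
    exact V.add_mem (hN n (le_of_max_le_left hn)) (hN' n (le_of_max_le_right hn))
  smul_mem' := by
    rintro r x ⟨N, hN⟩
    refine ⟨N, fun n hn => ?_⟩
    simp only [map_smul]
    exact V.smul_mem r (hN n hn)

lemma mem_eventuallyMem {x : A} : x ∈ S.eventuallyMem V ↔
    ∃ N, ∀ n ≥ N, S.rightProj n (S.leftProj n x) ∈ V := Iff.rfl

lemma mem_of_mem_eventuallyMem {x : A} (hx : x ∈ S.primTot) (h : x ∈ S.eventuallyMem V) :
    x ∈ V := by
  obtain ⟨N, hN⟩ := h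
  have h := hN (N + 1) (by omega)
  rwa [leftProj_of_coprec_eq_zero hx.1, rightProj_of_cosucc_eq_zero hx.2] at h

end LeftSpan

end BidendriformData

namespace ForestSpace

open PlanarForest BidendriformData

/-! ### Totally primitive elements of the forest algebra -/

section Primitive

variable {K D : Type*} [Field K]

/-- The projection onto `Ker Δ_≺` kills the products `F u` with `u ∈ Ker Δ_≺`. -/
lemma leftProj_mul {u : ForestSpace K D} (hu : (data K D).coprec u = 0) (n : ℕ) :
    ∀ F : PlanarForest D, F ≠ nil → F.size < n →
      (data K D).leftProj n ((data K D).mul (ofForest K F) u) = 0 := by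
  induction n with
  | zero => intro F _ h; omega
  | succ n ih =>
    intro F hF hn
    have hpos := size_pos hF
    obtain ⟨m, rfl⟩ : ∃ m, n = m + 1 := ⟨n - 1, by omega⟩
    rw [leftProj_succ_apply, (isBialgebra K).coprec_mul_of_coprec_eq_zero _ hu, comul_ofForest]
    simp only [map_add, LinearMap.rTensor_tmul, TensorProduct.lift.tmul, LinearMap.flip_apply,
      leftProj_of_coprec_eq_zero hu, map_sumCuts]
    rw [sumCuts_congr (g := fun _ _ => 0), sumCuts_zero, add_zero, sub_self]
    intro c hc
    by_cases h1 : c.pruned = nil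
    · simp [h1]
    by_cases h2 : c.trunk = nil
    · simp [h2]
    have h3 := size_pos h2
    have h4 := degree_of_mem_cuts (fun _ => 1) hc
    rw [ih _ h1 (by simp only [size] at *; omega), map_zero]

/-- The projection onto `Ker Δ_≻` kills the products `F ≻ v` with `v ∈ Ker Δ_≻`. -/
lemma rightProj_succ {v : ForestSpace K D} (hv : (data K D).cosucc v = 0) (n : ℕ) :
    ∀ F : PlanarForest D, F ≠ nil → F.size < n →
      (data K D).rightProj n ((data K D).succ (ofForest K F) v) = 0 := by
  induction n with
  | zero => intro F _ h; omega
  | succ n ih =>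
    intro F hF hn
    have hpos := size_pos hF
    obtain ⟨m, rfl⟩ : ∃ m, n = m + 1 := ⟨n - 1, by omega⟩
    rw [rightProj_succ_apply, (isBialgebra K).cosucc_succ_of_cosucc_eq_zero _ hv, comul_ofForest]
    simp only [map_add, LinearMap.lTensor_tmul, TensorProduct.lift.tmul, LinearMap.flip_apply,
      rightProj_of_cosucc_eq_zero hv, map_sumCuts]
    rw [sumCuts_congr (g := fun _ _ => 0), sumCuts_zero, add_zero, sub_self]
    intro c hc
    by_cases h1 : c.pruned = nil
    · simp [h1]
    by_cases h2 : c.trunk = nil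
    · simp [h2]
    have h3 := size_pos h1
    have h4 := degree_of_mem_cuts (fun _ => 1) hc
    rw [ih _ h2 (by simp only [size] at *; omega), map_zero]

/-- The vertices `d` and the elements `a ≻ d` span a subspace `U` such that `U` and the
products `a u` with `u ∈ U` span `𝒜^D`. -/
lemma mulSuccSpan_vertex_eq_top :
    (data K D).mulSuccSpan (Submodule.span K (Set.range (vertex K))) = ⊤ := by
  refine eq_top_of_closed (fun d => ?_)
    (fun a _ x hx => prec_mem_mulSuccSpan (isDendriformAlgebra K) a hx)
    fun a _ x hx => succ_mem_mulSuccSpan (isDendriformAlgebra K) a hx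
  exact Submodule.mem_sup_left (Submodule.mem_sup_left (Submodule.subset_span ⟨d, rfl⟩))

/-- The totally primitive elements of `𝒜^D` are the linear combinations of vertices: the two
projections fix the totally primitive elements, and send all elements to combinations of
vertices. -/
theorem primTot_eq_span : (data K D).primTot = Submodule.span K (Set.range (vertex K)) := by
  have bi := isBialgebra K (D := D)
  have hVle : Submodule.span K (Set.range (vertex K)) ≤ (data K D).primTot :=
    Submodule.span_le.2 fun x ⟨d, hd⟩ => hd ▸ vertex_mem_primTot d
  revert hVle
  generalize hV : Submodule.span K (Set.range (vertex (D := D) K)) = V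
  intro hVle
  have hW : (data K D).eventuallyMem V = ⊤ := by
    rw [eq_top_iff, ← mulSuccSpan_vertex_eq_top, hV]
    refine sup_le
      (sup_le (fun v hv => ⟨1, fun n hn => ?_⟩) (Submodule.map₂_le.2 fun a _ v hv => ?_))
      (Submodule.map₂_le.2 fun a _ u hu => ?_)
    · obtain ⟨m, rfl⟩ := Nat.exists_eq_add_of_le' hn
      rwa [leftProj_of_coprec_eq_zero (hVle hv).1, rightProj_of_cosucc_eq_zero (hVle hv).2]
    · induction a using forest_induction with
      | zero => simp
      | add x y hx hy =>
        rw [map_add]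
        exact Submodule.add_mem _ (hx trivial) (hy trivial)
      | smul r x hx =>
        rw [map_smul]
        exact Submodule.smul_mem _ r (hx trivial)
      | forest F hF =>
        refine mem_eventuallyMem.2 ⟨F.size + 1, fun n hn => ?_⟩
        obtain ⟨m, rfl⟩ : ∃ m, n = m + 1 := ⟨n - 1, by omega⟩
        rw [leftProj_of_coprec_eq_zero (bi.coprec_succ_of_coprec_eq_zero _ (hVle hv).1),
          rightProj_succ (hVle hv).2 (m + 1) F hF (by omega)]
        exact V.zero_mem
    · induction a using forest_induction with
      | zero => simp
      | add x y hx hy =>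
        rw [map_add]
        exact Submodule.add_mem _ (hx trivial) (hy trivial)
      | smul r x hx =>
        rw [map_smul]
        exact Submodule.smul_mem _ r (hx trivial)
      | forest F hF =>
        refine mem_eventuallyMem.2 ⟨F.size + 1, fun n hn => ?_⟩
        rw [leftProj_mul (bi.succSpan_le_ker_coprec hVle hu) n F hF (by omega), map_zero]
        exact V.zero_mem
  exact le_antisymm (fun x hx => mem_of_mem_eventuallyMem hx (hW ▸ trivial)) hVle

end Primitive

/-! ### Injectivity and surjectivity of morphisms from forests -/

section Injective

variable {K D A : Type*} [Field K] [AddCommGroup A] [Module K A] {S : BidendriformData K A}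

/-- The span of the forests with at most `n` vertices. -/
noncomputable def sizeFil (K D : Type*) [Field K] (n : ℕ) : Submodule K (ForestSpace K D) :=
  Submodule.span K (ofForest K '' {F | F.size ≤ n})

lemma coproducts_mem_sizeFil (b : Bool) {n : ℕ} {F : PlanarForest D} (hF : F.size ≤ n + 1) :
    (sumCutsOf b F fun p t => ofForest K p ⊗ₜ[K] ofForest K t) ∈
      LinearMap.range (TensorProduct.mapIncl (sizeFil K D n) (sizeFil K D n)) := by
  unfold sumCutsOf
  refine list_sum_mem fun x hx => ?_
  obtain ⟨c, hc, rfl⟩ := List.mem_map.1 hx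
  split
  · by_cases h1 : c.pruned = nil
    · simp [h1]
    by_cases h2 : c.trunk = nil
    · simp [h2]
    have h3 := size_pos h1
    have h4 := size_pos h2
    have h5 := degree_of_mem_cuts (fun _ => 1) hc
    have h6 : ∀ G : PlanarForest D, G.size ≤ n → ofForest K G ∈ sizeFil K D n := fun G hG =>
      Submodule.subset_span ⟨G, hG, rfl⟩
    change c.pruned.size + c.trunk.size = F.size at h5
    exact ⟨⟨_, h6 c.pruned (by omega)⟩ ⊗ₜ ⟨_, h6 c.trunk (by omega)⟩, rfl⟩
  · exact Submodule.zero_mem _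

/-- A morphism which is injective on the vertices is injective: an element of its kernel
with the fewest vertices is totally primitive, because the coproducts only involve forests with
fewer vertices; hence it is a combination of vertices. -/
theorem injective_of_linearIndependent {Ψ : ForestSpace K D →ₗ[K] A}
    (hΨ : (data K D).IsHom S Ψ) (h : LinearIndependent K fun d => Ψ (vertex K d)) :
    Function.Injective Ψ := by
  have key : ∀ n, ∀ x ∈ sizeFil K D n, Ψ x = 0 → x = 0 := by
    intro n
    induction n with
    | zero =>
      intro x hx _
      have : sizeFil K D 0 = ⊥ := by
        refine (Submodule.span_eq_bot).2 ?_
        rintro _ ⟨F, hF, rfl⟩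
        cases F with
        | nil => rfl
        | cons d C R =>
          have := size_pos (cons_ne_nil d C R)
          exact absurd hF (by simp; omega)
      rw [this] at hx
      exact hx
    | succ n ih =>
      intro x hx hx0
      have hinj : Function.Injective (TensorProduct.map (Ψ ∘ₗ (sizeFil K D n).subtype)
          (Ψ ∘ₗ (sizeFil K D n).subtype)) := by
        have h0 : Function.Injective (Ψ ∘ₗ (sizeFil K D n).subtype) :=
          (injective_iff_map_eq_zero _).2 fun y hy => Subtype.ext (ih y y.2 hy)
        exact TensorProduct.map_injective_of_flat_flat _ _ h0 h0
      have hzero : ∀ y ∈ LinearMap.range (TensorProduct.mapIncl (sizeFil K D n) (sizeFil K D n)),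
          TensorProduct.map Ψ Ψ y = 0 → y = 0 := by
        rintro _ ⟨z, rfl⟩ hz
        rw [TensorProduct.mapIncl, ← LinearMap.comp_apply, ← TensorProduct.map_comp] at hz
        rw [hinj (hz.trans (map_zero _).symm), map_zero]
      have h1 : sizeFil K D (n + 1) ≤ (LinearMap.range
          (TensorProduct.mapIncl (sizeFil K D n) (sizeFil K D n))).comap (data K D).coprec := by
        refine Submodule.span_le.2 ?_
        rintro _ ⟨F, hF, rfl⟩
        rw [SetLike.mem_coe, Submodule.mem_comap, coprec_ofForest]
        exact coproducts_mem_sizeFil true hF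
      have h2 : sizeFil K D (n + 1) ≤ (LinearMap.range
          (TensorProduct.mapIncl (sizeFil K D n) (sizeFil K D n))).comap (data K D).cosucc := by
        refine Submodule.span_le.2 ?_
        rintro _ ⟨F, hF, rfl⟩
        rw [SetLike.mem_coe, Submodule.mem_comap, cosucc_ofForest]
        exact coproducts_mem_sizeFil false hF
      have hprim : x ∈ (data K D).primTot :=
        ⟨hzero _ (h1 hx) (by rw [← hΨ.map_coprec, hx0, map_zero]),
          hzero _ (h2 hx) (by rw [← hΨ.map_cosucc, hx0, map_zero])⟩
      rw [primTot_eq_span, Finsupp.mem_span_range_iff_exists_finsupp] at hprim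
      obtain ⟨c, rfl⟩ := hprim
      have hc : c = 0 := by
        refine linearIndependent_iff.1 h c ?_
        rw [← hx0, Finsupp.linearCombination_apply, map_finsuppSum]
        simp only [map_smul]
      simp [hc]
  refine (injective_iff_map_eq_zero _).2 fun x hx => ?_
  have hfil : ∃ n, x ∈ sizeFil K D n := by
    have mono : ∀ {m n}, m ≤ n → sizeFil K D m ≤ sizeFil K D n := fun hmn =>
      Submodule.span_mono (Set.image_mono fun F hF => le_trans hF hmn)
    clear hx
    induction x using forest_induction with
    | zero => exact ⟨0, Submodule.zero_mem _⟩
    | add x y hx hy =>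
      obtain ⟨m, hm⟩ := hx
      obtain ⟨n, hn⟩ := hy
      exact ⟨max m n, Submodule.add_mem _ (mono (le_max_left _ _) hm) (mono (le_max_right _ _) hn)⟩
    | smul r x hx =>
      obtain ⟨m, hm⟩ := hx
      exact ⟨m, Submodule.smul_mem _ r hm⟩
    | forest F _ => exact ⟨F.size, Submodule.subset_span ⟨F, le_refl F.size, rfl⟩⟩
  obtain ⟨n, hn⟩ := hfil
  exact key n x hn hx

/-- A morphism to a connected bidendriform bialgebra is surjective if all totally primitive
elements are in its image. -/
theorem surjective_of_primTot_le (hS : S.IsBialgebra) (hc : S.IsConnected)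
    {Ψ : ForestSpace K D →ₗ[K] A} (hΨ : (data K D).IsHom S Ψ)
    (h : S.primTot ≤ LinearMap.range Ψ) : Function.Surjective Ψ := by
  refine LinearMap.range_eq_top.1 (hS.eq_top_of_primTot_le hc ?_ h)
  have hmap : ∀ y, TensorProduct.map Ψ Ψ y ∈
      LinearMap.range (TensorProduct.mapIncl (LinearMap.range Ψ) (LinearMap.range Ψ)) := fun y =>
    ⟨TensorProduct.map Ψ.rangeRestrict Ψ.rangeRestrict y, by
      rw [TensorProduct.mapIncl, ← LinearMap.comp_apply, ← TensorProduct.map_comp,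
        LinearMap.subtype_comp_codRestrict]⟩
  constructor
  · rintro _ ⟨a, rfl⟩ _ ⟨b, rfl⟩
    exact ⟨_, hΨ.map_prec a b⟩
  · rintro _ ⟨a, rfl⟩ _ ⟨b, rfl⟩
    exact ⟨_, hΨ.map_succ a b⟩
  · rintro _ ⟨a, rfl⟩
    rw [hΨ.map_coprec]
    exact hmap _
  · rintro _ ⟨a, rfl⟩
    rw [hΨ.map_cosucc]
    exact hmap _

end Injective

end ForestSpace

namespace BidendriformData

/-! ### Bijective morphisms -/

section Bijective

variable {K A B : Type*} [Field K] [AddCommGroup A] [Module K A] [AddCommGroup B] [Module K B]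
  {S : BidendriformData K A} {T : BidendriformData K B} {Ψ : A →ₗ[K] B}

lemma IsHom.isIso_of_bijective (hΨ : S.IsHom T Ψ) (h : Function.Bijective Ψ) : S.IsIso T Ψ := by
  let e := LinearEquiv.ofBijective Ψ h
  have h1 : ∀ y, Ψ (e.symm y) = y := e.apply_symm_apply
  have h2 : ∀ x, e.symm (Ψ x) = x := e.symm_apply_apply
  have h3 : e.symm.toLinearMap ∘ₗ Ψ = LinearMap.id := LinearMap.ext h2
  have h4 : Ψ ∘ₗ e.symm.toLinearMap = LinearMap.id := LinearMap.ext h1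
  have h5 : ∀ z, TensorProduct.map e.symm.toLinearMap e.symm.toLinearMap
      (TensorProduct.map Ψ Ψ z) = z := fun z => by
    rw [← LinearMap.comp_apply, ← TensorProduct.map_comp, h3, TensorProduct.map_id,
      LinearMap.id_apply]
  refine ⟨hΨ, e.symm.toLinearMap, ⟨fun a b => ?_, fun a b => ?_, fun a => ?_, fun a => ?_⟩, h3, h4⟩
  · apply h.1
    rw [hΨ.map_prec]
    simp only [LinearEquiv.coe_coe, h1]
  · apply h.1
    rw [hΨ.map_succ]
    simp only [LinearEquiv.coe_coe, h1]
  · conv_rhs => rw [← h1 a, hΨ.map_coprec, h5]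
    rfl
  · conv_rhs => rw [← h1 a, hΨ.map_cosucc, h5]
    rfl

end Bijective

end BidendriformData

namespace BidendriformData

/-! ### Homogeneity of the totally primitive elements -/

section Grading

variable {K A : Type*} [Field K] [AddCommGroup A] [Module K A] {S : BidendriformData K A}
  {𝒜 : ℕ → Submodule K A}

/-- The projections onto the homogeneous components of a direct sum decomposition. -/
lemma exists_projections (h : DirectSum.IsInternal 𝒜) : ∃ π : ℕ → A →ₗ[K] A,
    (∀ n x, π n x ∈ 𝒜 n) ∧ (∀ n, ∀ x ∈ 𝒜 n, π n x = x) ∧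
    (∀ m n, m ≠ n → ∀ x ∈ 𝒜 m, π n x = 0) ∧
    (∀ x, ∃ N, ∀ M ≥ N, ∑ n ∈ Finset.range M, π n x = x) := by
  classical
  let dec := h.chooseDecomposition
  let π : ℕ → A →ₗ[K] A := fun n =>
    (𝒜 n).subtype ∘ₗ DirectSum.component K ℕ (fun i => 𝒜 i) n ∘ₗ
      (DirectSum.decomposeLinearEquiv 𝒜).toLinearMap
  have hπ : ∀ n x, π n x = DirectSum.decompose 𝒜 x n := fun n x => rfl
  have h1 : ∀ n, ∀ x ∈ 𝒜 n, π n x = x := fun n x hx => by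
    rw [hπ, DirectSum.decompose_of_mem_same 𝒜 hx]
  have h2 : ∀ m n, m ≠ n → ∀ x ∈ 𝒜 m, π n x = 0 := fun m n hmn x hx => by
    rw [hπ, DirectSum.decompose_of_mem_ne 𝒜 hx hmn]
  refine ⟨π, fun n x => (DirectSum.decompose 𝒜 x n).2, h1, h2, fun x => ?_⟩
  have hx : x ∈ ⨆ n, 𝒜 n := h.submodule_iSup_eq_top ▸ trivial
  induction hx using Submodule.iSup_induction' with
  | mem n x hx =>
    refine ⟨n + 1, fun M hM => ?_⟩
    rw [Finset.sum_eq_single_of_mem n (Finset.mem_range.2 (by omega))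
      (fun m _ hm => h2 n m hm.symm x hx), h1 n x hx]
  | zero => exact ⟨0, fun M _ => by simp⟩
  | add x y _ _ hx hy =>
    obtain ⟨N, hN⟩ := hx
    obtain ⟨N', hN'⟩ := hy
    refine ⟨max N N', fun M hM => ?_⟩
    simp only [map_add, Finset.sum_add_distrib]
    rw [hN M (le_of_max_le_left hM), hN' M (le_of_max_le_right hM)]

/-- An element of `A ⊗ A` all of whose bihomogeneous components vanish is zero. -/
lemma eq_zero_of_map_projections {π : ℕ → A →ₗ[K] A}
    (hπ : ∀ x, ∃ N, ∀ M ≥ N, ∑ n ∈ Finset.range M, π n x = x) {y : A ⊗[K] A}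
    (hy : ∀ i j, TensorProduct.map (π i) (π j) y = 0) : y = 0 := by
  have key : ∃ N, ∀ M ≥ N, ∑ i ∈ Finset.range M, ∑ j ∈ Finset.range M,
      TensorProduct.map (π i) (π j) y = y := by
    clear hy
    induction y with
    | zero => exact ⟨0, fun M _ => by simp⟩
    | add x y hx hy =>
      obtain ⟨N, hN⟩ := hx
      obtain ⟨N', hN'⟩ := hy
      refine ⟨max N N', fun M hM => ?_⟩
      simp only [map_add, Finset.sum_add_distrib]
      rw [hN M (le_of_max_le_left hM), hN' M (le_of_max_le_right hM)]
    | tmul s t =>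
      obtain ⟨N, hN⟩ := hπ s
      obtain ⟨N', hN'⟩ := hπ t
      refine ⟨max N N', fun M hM => ?_⟩
      simp only [TensorProduct.map_tmul, ← TensorProduct.tmul_sum, ← TensorProduct.sum_tmul]
      rw [hN M (le_of_max_le_left hM), hN' M (le_of_max_le_right hM)]
  obtain ⟨N, hN⟩ := key
  rw [← hN N le_rfl]
  simp [hy]

/-- A homogeneous coproduct which vanishes on `a` vanishes on the homogeneous components of
`a`. -/
lemma coproduct_projection_eq_zero {π : ℕ → A →ₗ[K] A} (h1 : ∀ n x, π n x ∈ 𝒜 n)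
    (h2 : ∀ m n, m ≠ n → ∀ x ∈ 𝒜 m, π n x = 0)
    (h3 : ∀ x, ∃ N, ∀ M ≥ N, ∑ n ∈ Finset.range M, π n x = x) {δ : A →ₗ[K] A ⊗[K] A}
    (hδ : ∀ n : ℕ, ∀ a ∈ 𝒜 n, δ a ∈ ⨆ ij ∈ Finset.HasAntidiagonal.antidiagonal n,
      LinearMap.range (TensorProduct.mapIncl (𝒜 ij.1) (𝒜 ij.2)))
    {a : A} (ha : δ a = 0) (n : ℕ) : δ (π n a) = 0 := by
  have key : ∀ m i j, i + j ≠ m → ∀ b ∈ 𝒜 m, TensorProduct.map (π i) (π j) (δ b) = 0 := by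
    intro m i j hij b hb
    have hle : (⨆ ij ∈ Finset.HasAntidiagonal.antidiagonal m,
        LinearMap.range (TensorProduct.mapIncl (𝒜 ij.1) (𝒜 ij.2))) ≤
          LinearMap.ker (TensorProduct.map (π i) (π j)) := by
      refine iSup₂_le fun kl hkl => ?_
      rintro _ ⟨z, rfl⟩
      rw [Finset.HasAntidiagonal.mem_antidiagonal] at hkl
      rw [LinearMap.mem_ker, TensorProduct.mapIncl, ← LinearMap.comp_apply,
        ← TensorProduct.map_comp]
      by_cases hi : kl.1 = i
      · have hj : kl.2 ≠ j := by omega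
        have : π j ∘ₗ (𝒜 kl.2).subtype = 0 := LinearMap.ext fun x => h2 _ _ hj x x.2
        rw [this, TensorProduct.map_zero_right, LinearMap.zero_apply]
      · have : π i ∘ₗ (𝒜 kl.1).subtype = 0 := LinearMap.ext fun x => h2 _ _ hi x x.2
        rw [this, TensorProduct.map_zero_left, LinearMap.zero_apply]
    exact hle (hδ m b hb)
  refine eq_zero_of_map_projections h3 fun i j => ?_
  by_cases hij : i + j = n
  · -- Only the component of `a` of degree `n = i + j` contributes to the component `(i, j)`.
    obtain ⟨N, hN⟩ := h3 a
    have e : TensorProduct.map (π i) (π j) (δ a) =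
        TensorProduct.map (π i) (π j) (δ (π n a)) := by
      conv_lhs => rw [← hN (max N (n + 1)) (le_max_left _ _)]
      rw [map_sum, map_sum, Finset.sum_eq_single_of_mem n (Finset.mem_range.2 (by omega))]
      exact fun m _ hm => key m i j (by omega) _ (h1 m a)
    rw [← e, ha, map_zero]
  · exact key n i j hij _ (h1 n a)

/-- The space of totally primitive elements of a graded bidendriform bialgebra is graded. -/
lemma IsGrading.span_homogeneous_primTot (h : S.IsGrading 𝒜) :
    Submodule.span K {x | x ∈ S.primTot ∧ ∃ n, x ∈ 𝒜 n} = S.primTot := by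
  obtain ⟨π, h1, -, h3, h4⟩ := exists_projections h.isInternal
  refine le_antisymm (Submodule.span_le.2 fun x hx => hx.1) fun x hx => ?_
  obtain ⟨N, hN⟩ := h4 x
  rw [← hN N le_rfl]
  exact Submodule.sum_mem _ fun n _ => Submodule.subset_span
    ⟨⟨coproduct_projection_eq_zero h1 h3 h4 h.coprec_mem hx.1 n,
      coproduct_projection_eq_zero h1 h3 h4 h.cosucc_mem hx.2 n⟩, n, h1 n x⟩

end Grading

end BidendriformData

namespace ForestSpace

open PlanarForest BidendriformData

/-! ### Gradings of the forest algebra -/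

section Grading

variable {K D : Type*} [Field K] (deg : D → ℕ)

lemma ofForest_mem_grading (F : PlanarForest D) : ofForest K F ∈ grading K deg (F.degree deg) := by
  by_cases hF : F = nil
  · subst hF; exact Submodule.zero_mem _
  · exact Submodule.subset_span ⟨F, hF, rfl, rfl⟩

lemma extend_mem {M : Type*} [AddCommGroup M] [Module K M] {m : ℕ} {W : Submodule K M}
    {f : PlanarForest D → M} (hf : ∀ F : PlanarForest D, F.degree deg = m → f F ∈ W) :
    ∀ x ∈ grading K deg m, extend K f x ∈ W := by
  have : grading K deg m ≤ W.comap (extend K f) := by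
    refine Submodule.span_le.2 ?_
    rintro _ ⟨F, hF, hm, rfl⟩
    rw [SetLike.mem_coe, Submodule.mem_comap, extend_ofForest K f hF]
    exact hf F hm
  exact fun x hx => this hx

lemma precForest_mem_grading (F G : PlanarForest D) :
    precForest K F G ∈ grading K deg (F.degree deg + G.degree deg) := by
  induction F with
  | nil => exact Submodule.zero_mem _
  | cons d C R _ ih =>
    rw [precForest_cons]
    refine Submodule.sub_mem _ (Submodule.add_mem _ ?_ (extend_mem deg (fun Y hY => ?_) _ ih))
      (extend_mem deg (fun Y hY => ?_) _ ih)
    · convert ofForest_mem_grading deg (cons d (C.append (R.append G)) nil) using 2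
      simp only [degree, degree_append]; ring
    · convert ofForest_mem_grading deg (cons d C Y) using 2
      simp only [degree, hY]; ring
    · convert ofForest_mem_grading deg (cons d (C.append Y) nil) using 2
      simp only [degree, degree_append, hY]; ring

lemma succForest_mem_grading (F G : PlanarForest D) :
    succForest K F G ∈ grading K deg (F.degree deg + G.degree deg) := by
  refine Submodule.sub_mem _ ?_ (precForest_mem_grading deg F G)
  rw [← degree_append]
  exact ofForest_mem_grading deg _

lemma sumCutsOf_mem_grading (b : Bool) (F : PlanarForest D) :
    (sumCutsOf b F fun p t => ofForest K p ⊗ₜ[K] ofForest K t) ∈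
      ⨆ ij ∈ Finset.HasAntidiagonal.antidiagonal (F.degree deg),
        LinearMap.range (TensorProduct.mapIncl (grading K deg ij.1) (grading K deg ij.2)) := by
  refine list_sum_mem fun x hx => ?_
  obtain ⟨c, hc, rfl⟩ := List.mem_map.1 hx
  split
  · refine Submodule.mem_iSup_of_mem (c.pruned.degree deg, c.trunk.degree deg)
      (Submodule.mem_iSup_of_mem
        (Finset.HasAntidiagonal.mem_antidiagonal.2 (degree_of_mem_cuts deg hc)) ?_)
    exact ⟨⟨_, ofForest_mem_grading deg c.pruned⟩ ⊗ₜ ⟨_, ofForest_mem_grading deg c.trunk⟩, rfl⟩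
  · exact Submodule.zero_mem _

/-- The components are spanned by disjoint sets of forests, which form a basis. -/
lemma isInternal_grading : DirectSum.IsInternal (grading (D := D) K deg) := by
  classical
  rw [DirectSum.isInternal_submodule_iff_iSupIndep_and_iSup_eq_top]
  constructor
  · -- The projection on the forests of degree `n` separates the components.
    let π : ℕ → ForestSpace K D →ₗ[K] ForestSpace K D := fun n =>
      extend K fun F => if F.degree deg = n then ofForest K F else 0
    have h1 : ∀ n, ∀ x ∈ grading K deg n, π n x = x := by
      intro n
      have : grading K deg n ≤ LinearMap.eqLocus (π n) LinearMap.id := by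
        refine Submodule.span_le.2 ?_
        rintro _ ⟨F, hF, hn, rfl⟩
        change extend K _ (ofForest K F) = ofForest K F
        rw [extend_ofForest K _ hF, if_pos hn]
      exact fun x hx => this hx
    have h2 : ∀ m n, m ≠ n → grading K deg m ≤ LinearMap.ker (π n) := by
      intro m n hmn
      refine Submodule.span_le.2 ?_
      rintro _ ⟨F, hF, hm, rfl⟩
      change extend K _ (ofForest K F) = 0
      rw [extend_ofForest K _ hF, if_neg (by omega)]
    rw [iSupIndep_def]
    intro n
    rw [Submodule.disjoint_def]
    intro x hx hx'
    rw [← h1 n x hx]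
    exact (iSup₂_le fun m hm => h2 m n hm : (⨆ m, ⨆ (_ : m ≠ n), grading K deg m) ≤ _) hx'
  · refine eq_top_iff.2 fun x _ => ?_
    induction x using forest_induction with
    | zero => exact Submodule.zero_mem _
    | add x y hx hy => exact Submodule.add_mem _ (hx trivial) (hy trivial)
    | smul r x hx => exact Submodule.smul_mem _ r (hx trivial)
    | forest F _ => exact Submodule.mem_iSup_of_mem _ (ofForest_mem_grading deg F)

theorem isGrading : (data K D).IsGrading (grading K deg) where
  isInternal := isInternal_grading deg
  prec_mem i j a ha b hb := by
    simp only [data, extend₂]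
    refine extend_mem deg (W := (grading K deg (i + j)).comap (LinearMap.applyₗ b))
      (fun F hF => ?_) a ha
    rw [Submodule.mem_comap, LinearMap.applyₗ_apply_apply]
    exact extend_mem deg (fun G hG => hF ▸ hG ▸ precForest_mem_grading deg F G) b hb
  succ_mem i j a ha b hb := by
    simp only [data, extend₂]
    refine extend_mem deg (W := (grading K deg (i + j)).comap (LinearMap.applyₗ b))
      (fun F hF => ?_) a ha
    rw [Submodule.mem_comap, LinearMap.applyₗ_apply_apply]
    exact extend_mem deg (fun G hG => hF ▸ hG ▸ succForest_mem_grading deg F G) b hb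
  coprec_mem n a ha := by
    simp only [data]
    refine extend_mem deg (fun F hF => ?_) a ha
    rw [cutSum_eq, ← hF]
    exact sumCutsOf_mem_grading deg true F
  cosucc_mem n a ha := by
    simp only [data]
    refine extend_mem deg (fun F hF => ?_) a ha
    rw [cutSum_eq, ← hF]
    exact sumCutsOf_mem_grading deg false F

variable {deg} {A : Type*} [AddCommGroup A] [Module K A] {S : BidendriformData K A}
  {𝒜 : ℕ → Submodule K A}

lemma map_ofForest_mem (h𝒜 : S.IsGrading 𝒜) {Ψ : ForestSpace K D →ₗ[K] A}
    (hΨ : (data K D).IsHom S Ψ) (hdeg : ∀ d, Ψ (vertex K d) ∈ 𝒜 (deg d)) (F : PlanarForest D) :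
    Ψ (ofForest K F) ∈ 𝒜 (F.degree deg) := by
  induction F with
  | nil => rw [ofForest_nil, map_zero]; exact Submodule.zero_mem _
  | cons d C R ihC ihR =>
    have ht : Ψ (ofForest K (cons d C nil)) ∈ 𝒜 (deg d + C.degree deg) := by
      by_cases hC : C = nil
      · subst hC; exact hdeg d
      · rw [ofForest_graft_eq_prec d hC, hΨ.map_prec]
        exact h𝒜.prec_mem _ _ _ (hdeg d) _ ihC
    by_cases hR : R = nil
    · subst hR; exact ht
    · rw [ofForest_cons_eq_mul d C hR, BidendriformData.mul_apply, map_add, hΨ.map_prec,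
        hΨ.map_succ]
      exact Submodule.add_mem _ (h𝒜.prec_mem _ _ _ ht _ ihR) (h𝒜.succ_mem _ _ _ ht _ ihR)

/-- A bijective morphism which preserves the degrees of the vertices is an isomorphism of graded
bidendriform bialgebras. -/
lemma isGradedIso_of_bijective (h𝒜 : S.IsGrading 𝒜) {Ψ : ForestSpace K D →ₗ[K] A}
    (hΨ : (data K D).IsHom S Ψ) (hdeg : ∀ d, Ψ (vertex K d) ∈ 𝒜 (deg d))
    (hbij : Function.Bijective Ψ) :
    (data K D).IsGradedIso (grading K deg) S 𝒜 Ψ := by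
  have hle : ∀ n, (grading K deg n).map Ψ ≤ 𝒜 n := by
    intro n
    refine Submodule.map_le_iff_le_comap.2 (Submodule.span_le.2 ?_)
    rintro _ ⟨F, _, rfl, rfl⟩
    exact map_ofForest_mem h𝒜 hΨ hdeg F
  refine ⟨hΨ.isIso_of_bijective hbij, fun n => le_antisymm (hle n) fun y hy => ?_⟩
  obtain ⟨x, rfl⟩ := hbij.2 y
  obtain ⟨π, -, h2, h3, -⟩ := exists_projections h𝒜.isInternal
  obtain ⟨ϖ, k1, -, -, k4⟩ := exists_projections (isInternal_grading (K := K) deg)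
  obtain ⟨N, hN⟩ := k4 x
  -- The component of `x` of degree `n` is a preimage of the homogeneous element `Ψ x`.
  refine ⟨ϖ n x, k1 n x, ?_⟩
  rw [← h2 n _ hy]
  conv_rhs => rw [← hN (max N (n + 1)) (le_max_left _ _)]
  rw [map_sum, map_sum, Finset.sum_eq_single_of_mem n (Finset.mem_range.2 (by omega)),
    h2 n _ (hle n ⟨_, k1 n x, rfl⟩)]
  exact fun m _ hm => h3 m n hm _ (hle m ⟨_, k1 m x, rfl⟩)

end Grading

/-! ### The structure theorem -/

section Structure

variable {K A D : Type*} [Field K] [AddCommGroup A] [Module K A] {S : BidendriformData K A}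

/-- If totally primitive elements `p d` form a basis of `Prim_tot(A)` and `A` is connected, then the
morphism sending each vertex `d` to `p d` is bijective. -/
theorem bijective_of_basis (hS : S.IsBialgebra) (hc : S.IsConnected)
    {Ψ : ForestSpace K D →ₗ[K] A} (hΨ : (data K D).IsHom S Ψ) {p : D → A}
    (hp : ∀ d, Ψ (vertex K d) = p d) (hli : LinearIndependent K p)
    (hspan : Submodule.span K (Set.range p) = S.primTot) : Function.Bijective Ψ := by
  refine ⟨injective_of_linearIndependent hΨ (by simpa only [hp] using hli),
    surjective_of_primTot_le hS hc hΨ ?_⟩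
  rw [← hspan, Submodule.span_le]
  rintro _ ⟨d, rfl⟩
  exact ⟨_, hp d⟩

end Structure

end ForestSpace

theorem mainTheorem2 {K A D : Type*} [Field K] [AddCommGroup A] [Module K A]
    (S : BidendriformData K A) (hS : S.IsBialgebra) :
    -- `𝒜^D` is a bidendriform bialgebra in which the vertices are totally primitive
    ((ForestSpace.data K D).IsBialgebra ∧
      ∀ d : D, ForestSpace.vertex K d ∈ (ForestSpace.data K D).primTot) ∧
    -- its universal property
    (∀ p : D → A, (∀ d, p d ∈ S.primTot) →
      ∃ Ψ : ForestSpace K D →ₗ[K] A,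
        ((ForestSpace.data K D).IsHom S Ψ ∧ ∀ d, Ψ (ForestSpace.vertex K d) = p d) ∧
        (∀ Ψ' : ForestSpace K D →ₗ[K] A,
          (ForestSpace.data K D).IsHom S Ψ' → (∀ d, Ψ' (ForestSpace.vertex K d) = p d) →
            Ψ' = Ψ) ∧
        (LinearIndependent K p → Function.Injective Ψ) ∧
        (S.IsConnected → Submodule.span K (Set.range p) = S.primTot → Function.Surjective Ψ) ∧
        (S.IsConnected → LinearIndependent K p → Submodule.span K (Set.range p) = S.primTot →
          (ForestSpace.data K D).IsIso S Ψ)) ∧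
    -- the graded case
    (∀ 𝒜 : ℕ → Submodule K A, S.IsGrading 𝒜 → S.IsConnected →
      ∀ (p : D → A) (deg : D → ℕ), LinearIndependent K p →
        Submodule.span K (Set.range p) = S.primTot → (∀ d, p d ∈ 𝒜 (deg d)) →
        (ForestSpace.data K D).IsGrading (ForestSpace.grading K deg) ∧
        ∀ Ψ : ForestSpace K D →ₗ[K] A,
          (ForestSpace.data K D).IsHom S Ψ → (∀ d, Ψ (ForestSpace.vertex K d) = p d) →
            (ForestSpace.data K D).IsGradedIso (ForestSpace.grading K deg) S 𝒜 Ψ) ∧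
    -- connected bidendriform bialgebras are isomorphic to some `𝒜^B`
    (S.IsConnected → ∃ B : Set A,
      LinearIndependent K (fun b : B => (b : A)) ∧ Submodule.span K B = S.primTot ∧
      ∃ Ψ : ForestSpace K B →ₗ[K] A,
        (ForestSpace.data K B).IsIso S Ψ ∧ ∀ b : B, Ψ (ForestSpace.vertex K b) = b) ∧
    -- connected graded bidendriform bialgebras are isomorphic to some graded `𝒜^B`
    (∀ 𝒜 : ℕ → Submodule K A, S.IsGrading 𝒜 → S.IsConnected →
      ∃ (B : Set A) (deg : B → ℕ),
        LinearIndependent K (fun b : B => (b : A)) ∧ Submodule.span K B = S.primTot ∧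
        (∀ b : B, (b : A) ∈ 𝒜 (deg b)) ∧
        (ForestSpace.data K B).IsGrading (ForestSpace.grading K deg) ∧
        ∃ Ψ : ForestSpace K B →ₗ[K] A,
          (ForestSpace.data K B).IsGradedIso (ForestSpace.grading K deg) S 𝒜 Ψ ∧
          ∀ b : B, Ψ (ForestSpace.vertex K b) = b) := by
  have hfam : ∀ {B : Set A}, Submodule.span K B = S.primTot →
      Submodule.span K (Set.range fun b : B => (b : A)) = S.primTot := fun h => by
    rwa [Subtype.range_coe]
  refine ⟨⟨ForestSpace.isBialgebra K, ForestSpace.vertex_mem_primTot⟩, fun p hp => ?_,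
    fun 𝒜 h𝒜 hc p deg hli hspan hdeg => ?_, fun hc => ?_, fun 𝒜 h𝒜 hc => ?_⟩
  · have hom := ForestSpace.isHom_extend_evalForest hS hp
    have hv := ForestSpace.extend_evalForest_vertex (K := K) (S := S) p
    refine ⟨_, ⟨hom, hv⟩, fun Ψ' hΨ' hv' => ?_, fun hli => ?_, fun hc hspan => ?_,
      fun hc hli hspan => ?_⟩
    · exact ForestSpace.hom_eq hΨ' hom fun d => (hv' d).trans (hv d).symm
    · exact ForestSpace.injective_of_linearIndependent hom (by simpa only [hv] using hli)
    · refine ForestSpace.surjective_of_primTot_le hS hc hom ?_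
      rw [← hspan, Submodule.span_le]
      rintro _ ⟨d, rfl⟩
      exact ⟨_, hv d⟩
    · exact hom.isIso_of_bijective (ForestSpace.bijective_of_basis hS hc hom hv hli hspan)
  · refine ⟨ForestSpace.isGrading deg, fun Ψ hΨ hv => ?_⟩
    exact ForestSpace.isGradedIso_of_bijective h𝒜 hΨ (fun d => (hv d).symm ▸ hdeg d)
      (ForestSpace.bijective_of_basis hS hc hΨ hv hli hspan)
  · obtain ⟨B, -, hB, hli⟩ := exists_linearIndependent K (S.primTot : Set A)
    rw [Submodule.span_eq] at hB
    have hp : ∀ b : B, (b : A) ∈ S.primTot := fun b => hB ▸ Submodule.subset_span b.2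
    have hom := ForestSpace.isHom_extend_evalForest hS hp
    have hv := ForestSpace.extend_evalForest_vertex (K := K) (S := S) fun b : B => (b : A)
    exact ⟨B, hli, hB, _,
      hom.isIso_of_bijective (ForestSpace.bijective_of_basis hS hc hom hv hli (hfam hB)), hv⟩
  · -- A basis is extracted from the homogeneous totally primitive elements.
    obtain ⟨B, hBsub, hB, hli⟩ :=
      exists_linearIndependent K {x | x ∈ S.primTot ∧ ∃ n, x ∈ 𝒜 n}
    rw [h𝒜.span_homogeneous_primTot] at hB
    choose deg hdeg using fun b : B => (hBsub b.2).2
    have hom := ForestSpace.isHom_extend_evalForest hS fun b : B => (hBsub b.2).1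
    have hv := ForestSpace.extend_evalForest_vertex (K := K) (S := S) fun b : B => (b : A)
    exact ⟨B, deg, hli, hB, hdeg, ForestSpace.isGrading deg, _,
      ForestSpace.isGradedIso_of_bijective h𝒜 hom (fun b => (hv b).symm ▸ hdeg b)
        (ForestSpace.bijective_of_basis hS hc hom hv hli (hfam hB)), hv⟩
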